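/- Let $\mathbb T^2=\mathbb R^2/\mathbb Z^2$, $V\in C^\infty(\mathbb T^2;\mathbb R)$, and let $\Lambda\subset\mathbb Z^2$ be a primitive sublattice of rank one, that is, its real span $\langle\Lambda\rangle$ is a line and $\langle\Lambda\rangle\cap\mathbb Z^2=\Lambda$. Let $\mathfrak e_\Lambda$ be a generator of $\Lambda$, $\mathfrak e_\Lambda^\perp$ the vector of the same length directly orthogonal to it, and $L_\Lambda=\|\mathfrak e_\Lambda\|$. On $T^*\mathbb T^2=\mathbb T^2\times\mathbb R^2$ put $$H_\Lambda(x,\xi)=\tfrac1{L_\Lambda}\langle\xi,\mathfrak e_\Lambda\rangle,\quad H_\Lambda^\perp(x,\xi)=\tfrac1{L_\Lambda}\langle\xi,\mathfrak e_\Lambda^\perp\rangle,\quad \mathcal I_\Lambda(V)(x)=\tfrac1{L_\Lambda}\int_0^{L_\Lambda}V\big(x+s\,\mathfrak e_\Lambda^\perp/L_\Lambda\big)\,ds,\quad p_\Lambda=\tfrac12H_\Lambda^2+\mathcal I_\Lambda(V),$$ and let $\varphi^s_{H_\Lambda^\perp}$, $\varphi^t_{p_\Lambda}$ be the (commuting,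 complete) Hamiltonian flows of $H_\Lambda^\perp$ and $p_\Lambda$. Let $\mathcal R(\Lambda)$ be the complement in $T^*\mathbb T^2$ of $\{(x,\xi): H_\Lambda(x,\xi)=0,\ \partial_x\mathcal I_\Lambda(V)(x)=0\}$, let $\Phi=(H_\Lambda^\perp,p_\Lambda):\mathcal R(\Lambda)\to\mathbb R^2$ be the moment map, and let $\mathcal L_{(H,J)}=\Phi^{-1}(H,J)$. For $z\in\mathcal R(\Lambda)$ let $\mathcal L^{z}_{\Phi(z)}$ be the connected component of $\mathcal L_{\Phi(z)}$ containing $z$, and let $\mathcal R_c(\Lambda)$ be the set of those $z$ for which it is compact; it is then a torus, identified with $\mathbb R^2/G_z$ through $(s,t)\mapsto\varphi^s_{H_\Lambda^\perp}\varphi^t_{p_\Lambda}(z)$, where $G_z$ is the stabilizer of $z$, and its normalized Haar measure is the image of the Haar probability measure of $\mathbb R^2/G_z$. Let $\mu$ be a probability measure on $\mathcal R(\Lambda)$ invariant under $\varphi^t_{H_\Lambda^\perp}$ and $\varphi^t_{p_\Lambda}$ for all $t\in\mathbb R$, and set $\overline\mu=\Phi_*\mu$. Then $\overline\mu$-almost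 every $(H,J)$ belongs to $\Phi(\mathcal R_c(\Lambda))$, and there is a $\overline\mu$-measurable family of finite measures $\lambda_{H,J}$, $(H,J)\in\Phi(\mathcal R(\Lambda))$, such that for every $a\in C_c(\mathcal R(\Lambda))$ the inner integral below is a $\overline\mu$-integrable function of $(H,J)$ and $$\int_{\mathcal R(\Lambda)}a\,d\mu=\int_{\Phi(\mathcal R(\Lambda))}\int_{\mathcal L_{(H,J)}}a\,d\lambda_{H,J}\ \overline\mu(dH,dJ).$$ For every $(H,J)\in\Phi(\mathcal R_c(\Lambda))$ the measure $\lambda_{H,J}$ is a countable (finite or infinite) convex combination of the normalized Haar measures on the tori $\mathcal L^{z}_{(H,J)}$, $z\in\mathcal L_{(H,J)}\cap\mathcal R_c(\Lambda)$; for the other $(H,J)\in\Phi(\mathcal R(\Lambda))$, which form a $\overline\mu$-null set, $\lambda_{H,J}=0$. Moreover, for every $z\in\mathcal R(\Lambda)$, $$\mu\big(\{\varphi^s_{H_\Lambda^\perp}(z):0\le s\le L_\Lambda\}\big)=0.$$ -/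

import Mathlib

open MeasureTheory Set
open scoped ContDiff ENNReal

noncomputable section

namespace BiInvariant

/-- The Euclidean plane `ℝ²`. -/
abbrev Plane : Type := EuclideanSpace ℝ (Fin 2)

/-- The flat torus `𝕋² = ℝ²/ℤ²`. -/
abbrev Torus : Type := UnitAddTorus (Fin 2)

/-- The cotangent bundle `T*𝕋² = 𝕋² × ℝ²`, with points `z = (x, ξ)`. -/
abbrev Phase : Type := Torus × Plane

/-- The canonical projection `ℝ² → 𝕋²`. -/
def toTorus (y : Plane) : Torus := fun i => (y i : UnitAddCircle)

/-- A function on the torus is smooth when its periodic lift to the plane is. -/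
def SmoothOnTorus (f : Torus → ℝ) : Prop := ContDiff ℝ ∞ (fun y : Plane => f (toTorus y))

/-- The gradient `∂ₓ f (x)` of a function on the torus (with the flat metric). -/
def torusGradient (f : Torus → ℝ) (x : Torus) : Plane :=
  gradient (fun y : Plane => f (x + toTorus y)) 0

/-! ### Hamiltonian flows on `T*𝕋²` -/

/-- `∂ₓ h (x, ξ)`. -/
def gradPos (h : Phase → ℝ) (z : Phase) : Plane := torusGradient (fun x => h (x, z.2)) z.1

/-- `∂_ξ h (x, ξ)`. -/
def gradMom (h : Phase → ℝ) (z : Phase) : Plane := gradient (fun ξ => h (z.1, ξ)) z.2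

/-- `γ : ℝ → T*𝕋²` solves Hamilton's equations `x' = ∂_ξ h`, `ξ' = -∂ₓ h` for all times.
The velocity of the position is computed on a lift of it to the plane. -/
def IsHamiltonianCurve (h : Phase → ℝ) (γ : ℝ → Phase) : Prop :=
  ∃ X Ξ : ℝ → Plane, ∀ t : ℝ, γ t = (toTorus (X t), Ξ t) ∧
    HasDerivAt X (gradMom h (γ t)) t ∧ HasDerivAt Ξ (-gradPos h (γ t)) t

open Classical in
/-- The Hamiltonian flow `φ_h^t` on `T*𝕋²`. For the complete Hamiltonian vector fields of class
`C¹` to which it is applied, the solution curve through `z` exists and is unique. -/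
def hamiltonianFlow (h : Phase → ℝ) (t : ℝ) (z : Phase) : Phase :=
  if hz : ∃ γ : ℝ → Phase, IsHamiltonianCurve h γ ∧ γ 0 = z then hz.choose t else z

/-! ### Primitive lattices of rank one and the associated Hamiltonians -/

/-- An integer vector, seen in the plane. -/
def vec (e : Fin 2 → ℤ) : Plane := !₂[(e 0 : ℝ), (e 1 : ℝ)]

/-- The vector of the same length that is directly orthogonal to `e`. -/
def perp (e : Fin 2 → ℤ) : Plane := !₂[-(e 1 : ℝ), (e 0 : ℝ)]

/-- `Λ` is a primitive sublattice of `ℤ²` of rank one: its real span `⟨Λ⟩` is a line and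
`⟨Λ⟩ ∩ ℤ² = Λ`. -/
def IsPrimitiveRankOne (Λ : AddSubgroup (Fin 2 → ℤ)) : Prop :=
  Module.finrank ℝ (Submodule.span ℝ (vec '' (Λ : Set (Fin 2 → ℤ)))) = 1 ∧
    ∀ k : Fin 2 → ℤ, vec k ∈ Submodule.span ℝ (vec '' (Λ : Set (Fin 2 → ℤ))) → k ∈ Λ

/-- The length `L_Λ` of the generator `e = 𝔢_Λ` of `Λ`. -/
def len (e : Fin 2 → ℤ) : ℝ := ‖vec e‖

/-- `H_Λ (x, ξ) = ⟨ξ, 𝔢_Λ⟩ / L_Λ`. -/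
def hamPar (e : Fin 2 → ℤ) (z : Phase) : ℝ := 1 / len e * inner ℝ z.2 (vec e)

/-- `H_Λ^⊥ (x, ξ) = ⟨ξ, 𝔢_Λ^⊥⟩ / L_Λ`. -/
def hamPerp (e : Fin 2 → ℤ) (z : Phase) : ℝ := 1 / len e * inner ℝ z.2 (perp e)

/-- The average `I_Λ(V)(x)` of `V` along the closed geodesic through `x` directed
by `𝔢_Λ^⊥`, that is, along the `L_Λ`-periodic flow of `H_Λ^⊥`. -/
def average (e : Fin 2 → ℤ) (V : Torus → ℝ) (x : Torus) : ℝ :=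
  1 / len e * ∫ s in (0 : ℝ)..len e, V (x + toTorus ((s / len e) • perp e))

/-- `p_Λ (x, ξ) = H_Λ(x, ξ)² / 2 + I_Λ(V)(x)`. -/
def hamP (e : Fin 2 → ℤ) (V : Torus → ℝ) (z : Phase) : ℝ :=
  hamPar e z ^ 2 / 2 + average e V z.1

/-- The critical set `Crit_Λ(V)`. -/
def crit (e : Fin 2 → ℤ) (V : Torus → ℝ) : Set Phase :=
  {z | hamPar e z = 0 ∧ torusGradient (average e V) z.1 = 0}

/-- `R(Λ)`, the complement of the critical set. -/
def regular (e : Fin 2 → ℤ) (V : Torus → ℝ) : Set Phase := (crit e V)ᶜ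

/-! ### The moment map, its level sets, and the invariant tori -/

/-- The moment map `Φ = (H_Λ^⊥, p_Λ)`. -/
def moment (e : Fin 2 → ℤ) (V : Torus → ℝ) (z : Phase) : ℝ × ℝ := (hamPerp e z, hamP e V z)

/-- The level set `L_{(H,J)} = Φ⁻¹(H, J)` in `R(Λ)`. -/
def levelSet (e : Fin 2 → ℤ) (V : Torus → ℝ) (h : ℝ × ℝ) : Set Phase :=
  {z ∈ regular e V | moment e V z = h}

/-- The connected component of the level set of `z` that contains `z`. -/
def component (e : Fin 2 → ℤ) (V : Torus → ℝ) (z : Phase) : Set Phase :=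
  connectedComponentIn (levelSet e V (moment e V z)) z

/-- `R_c(Λ)`: the points of `R(Λ)` whose component of the level set is compact. -/
def compactPart (e : Fin 2 → ℤ) (V : Torus → ℝ) : Set Phase :=
  {z ∈ regular e V | IsCompact (component e V z)}

/-- The orbit map `φ_z (s, t) = φ_{H_Λ^⊥}^s (φ_{p_Λ}^t z)` of the action of `ℝ²`. -/
def orbitMap (e : Fin 2 → ℤ) (V : Torus → ℝ) (z : Phase) (w : ℝ × ℝ) : Phase :=
  hamiltonianFlow (hamPerp e) w.1 (hamiltonianFlow (hamP e V) w.2 z)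

/-- The group `G_z` of periods of the orbit map of `z`. Since the two flows commute, so that
`ℝ²` acts, this is the stabilizer of `z`. -/
def periodGroup (e : Fin 2 → ℤ) (V : Torus → ℝ) (z : Phase) : AddSubgroup (ℝ × ℝ) where
  carrier := {g | ∀ w, orbitMap e V z (g + w) = orbitMap e V z w}
  zero_mem' := fun w => by rw [zero_add]
  add_mem' := fun {a b} ha hb w => by rw [add_assoc, ha, hb]
  neg_mem' := fun {a} ha w => by rw [← ha (-a + w), add_neg_cancel_left]

/-- The map `ℝ²/G_z → T*𝕋²` induced by the orbit map. -/
def torusMap (e : Fin 2 → ℤ) (V : Torus → ℝ) (z : Phase) :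
    (ℝ × ℝ) ⧸ periodGroup e V z → Phase :=
  fun q => Quotient.liftOn' q (orbitMap e V z) fun a b hab => by
    have h := QuotientAddGroup.leftRel_apply.mp hab a
    rw [neg_add_cancel_comm] at h
    exact h.symm

/-- `m` is the normalized Haar measure on the torus through `z`: the image under
`ℝ²/G_z → T*𝕋²` of the Haar probability measure of the group `ℝ²/G_z`. -/
def IsTorusHaar (e : Fin 2 → ℤ) (V : Torus → ℝ) (z : Phase) (m : Measure Phase) : Prop :=
  ∃ ν : Measure ((ℝ × ℝ) ⧸ periodGroup e V z),
    ν.IsAddHaarMeasure ∧ IsProbabilityMeasure ν ∧ m = ν.map (torusMap e V z)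

/-- `m` is a (countable) convex combination of normalized Haar measures on the compact connected
components of the level set of `h`. -/
def IsConvexCombOfTori (e : Fin 2 → ℤ) (V : Torus → ℝ) (h : ℝ × ℝ) (m : Measure Phase) : Prop :=
  ∃ (z : ℕ → Phase) (c : ℕ → ℝ≥0∞) (τ : ℕ → Measure Phase),
    (∀ n, z n ∈ levelSet e V h ∩ compactPart e V) ∧
    (∀ n, IsTorusHaar e V (z n) (τ n)) ∧
    ∑' n, c n = 1 ∧
    m = Measure.sum (fun n => c n • τ n)

end BiInvariant

end

open BiInvariant

/-!
In the coordinates of the orthonormal frame `(𝔢_Λ^⊥ / L_Λ, 𝔢_Λ / L_Λ)` the flow of `H_Λ^⊥` is a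
translation and the flow of `p_Λ` is Newton's equation on a line, for the potential `I_Λ(V)`. Off
the equilibria of this equation, which make up the critical set, the energy level of a solution is
locally its trajectory. Hence `ℝ²` acts locally transitively on the level sets `L_{(H,J)}`: the
orbits are open in them, so that they are the connected components, and countably many of them
cover.

Disintegrate `μ` along `Φ` by conditional distributions. For almost every `(H,J)` the conditional
distribution is invariant under a countable dense subset of `ℝ²`, hence by continuity under `ℝ²`,
and it is the sum of its restrictions to the countably many orbits of positive mass in `L_{(H,J)}`.
A finite invariant measure on an orbit is a Haar measure of `ℝ²/G_z`; as it is finite, this group,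
and with it the orbit, is compact.

An orbit of `H_Λ^⊥` is disjoint from its images under `φ_{p_Λ}^t` for small `t ≠ 0`. These have the
same measure, and there are infinitely many of them, pairwise disjoint for suitable `t`, so the
measure is zero.
-/

noncomputable section

namespace BiInvariant

open Filter Topology
open scoped NNReal

section OrbitTopology

open AddAction

theorem range_ofQuotientStabilizer {G X : Type*} [AddGroup G] [AddAction G X] (z : X) :
    range (ofQuotientStabilizer G z) = orbit G z :=
  (QuotientAddGroup.mk_surjective.range_comp (ofQuotientStabilizer G z)).symm

variable {G X : Type*} [AddGroup G] [AddAction G X] [TopologicalSpace G] [TopologicalSpace X]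

variable (G) in
/-- Local transitivity of the action of `G` on a subset `L` of `X`: arbitrarily small elements of
`G` move every point `x` of `L` over a neighbourhood of `x` in `L`. -/
def IsLocallyTransitiveOn (L : Set X) : Prop :=
  ∀ x ∈ L, ∀ T ∈ 𝓝 (0 : G), (fun g : G => g +ᵥ x) '' T ∈ 𝓝[L] x

theorem IsLocallyTransitiveOn.orbit_mem_nhdsWithin {L : Set X} (hL : IsLocallyTransitiveOn G L)
    {x : X} (hx : x ∈ L) : orbit G x ∈ 𝓝[L] x :=
  image_univ.subst (motive := (· ∈ 𝓝[L] x)) (hL x hx univ univ_mem)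

theorem isClopen_preimage_orbit {L : Set X} (hL : IsLocallyTransitiveOn G L) (z : X) :
    IsClopen ((↑) ⁻¹' orbit G z : Set L) := by
  have hnhds : ∀ x : L, ((↑) ⁻¹' orbit G (x : X) : Set L) ∈ 𝓝 x := fun x =>
    preimage_coe_mem_nhds_subtype.2 (hL.orbit_mem_nhdsWithin x.2)
  refine ⟨isOpen_compl_iff.1 (isOpen_iff_mem_nhds.2 fun x hx => ?_),
    isOpen_iff_mem_nhds.2 fun x hx => ?_⟩
  · refine mem_of_superset (hnhds x) fun y (hy : (y : X) ∈ orbit G (x : X)) hyz => hx ?_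
    exact orbit_eq_iff.1 ((orbit_eq_iff.2 hy).symm.trans (orbit_eq_iff.2 hyz))
  · have hxz : orbit G (x : X) = orbit G z := orbit_eq_iff.2 hx
    simpa only [hxz] using hnhds x

theorem connectedComponentIn_eq_orbit [PreconnectedSpace G] {L : Set X}
    (hcont : ∀ x : X, Continuous fun g : G => g +ᵥ x) (hinv : ∀ g : G, ∀ x ∈ L, g +ᵥ x ∈ L)
    (hL : IsLocallyTransitiveOn G L) {z : X} (hz : z ∈ L) :
    connectedComponentIn L z = orbit G z := by
  refine Subset.antisymm ?_ ((isPreconnected_range (hcont z)).subset_connectedComponentIn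
    (mem_orbit_self z) (range_subset_iff.2 fun g => hinv g z hz))
  rw [connectedComponentIn_eq_image hz, image_subset_iff]
  exact (isClopen_preimage_orbit hL z).connectedComponent_subset (mem_orbit_self z)

theorem isClosed_stabilizer [T1Space X] {z : X} (hz : Continuous fun g : G => g +ᵥ z) :
    IsClosed (stabilizer G z : Set G) :=
  isClosed_singleton.preimage hz

theorem continuous_ofQuotientStabilizer {z : X} (hz : Continuous fun g : G => g +ᵥ z) :
    Continuous (ofQuotientStabilizer G z) :=
  continuous_quot_lift _ hz

theorem isInducing_ofQuotientStabilizer [IsTopologicalAddGroup G] {L : Set X} {z : X}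
    (hz : Continuous fun g : G => g +ᵥ z) (hzL : orbit G z ⊆ L) (hL : IsLocallyTransitiveOn G L) :
    IsInducing (ofQuotientStabilizer G z) := by
  refine isInducing_iff_nhds.2 fun q =>
    le_antisymm (continuous_ofQuotientStabilizer hz).continuousAt.le_comap fun U hU => ?_
  have hqL : ∀ q, ofQuotientStabilizer G z q ∈ L := fun q =>
    hzL (range_ofQuotientStabilizer (G := G) z ▸ mem_range_self q)
  have hT : {g : G | g +ᵥ q ∈ U} ∈ 𝓝 (0 : G) := by
    have hc : Continuous fun g : G => g +ᵥ q := continuous_id.vadd continuous_const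
    exact hc.continuousAt.preimage_mem_nhds (by rwa [zero_vadd])
  obtain ⟨W, hW, hWL⟩ := mem_nhdsWithin_iff_exists_mem_nhds_inter.1 (hL _ (hqL q) _ hT)
  refine ⟨W, hW, fun q' hq' => ?_⟩
  obtain ⟨g, hg, hgq⟩ := hWL ⟨hq', hqL q'⟩
  rw [← injective_ofQuotientStabilizer G z ((ofQuotientStabilizer_vadd G z g q).trans hgq)]
  exact hg

theorem isCompact_orbit {z : X} [CompactSpace (G ⧸ stabilizer G z)]
    (hz : Continuous fun g : G => g +ᵥ z) : IsCompact (orbit G z) := by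
  rw [← range_ofQuotientStabilizer]
  exact isCompact_range (continuous_ofQuotientStabilizer hz)

theorem compactSpace_quotient_stabilizer [IsTopologicalAddGroup G] {L : Set X} {z : X}
    (hz : Continuous fun g : G => g +ᵥ z) (hzL : orbit G z ⊆ L) (hL : IsLocallyTransitiveOn G L)
    (hc : IsCompact (orbit G z)) : CompactSpace (G ⧸ stabilizer G z) := by
  rw [← isCompact_univ_iff, (isInducing_ofQuotientStabilizer hz hzL hL).isCompact_iff, image_univ,
    range_ofQuotientStabilizer]
  exact hc

end OrbitTopology

section OrbitMeasure

open AddAction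
open scoped Pointwise

theorem measurableSet_orbit {G X : Type*} [AddMonoid G] [AddAction G X] [TopologicalSpace G]
    [SigmaCompactSpace G] [TopologicalSpace X] [T2Space X] [MeasurableSpace X] [BorelSpace X]
    {z : X} (hz : Continuous fun g : G => g +ᵥ z) :
    MeasurableSet (orbit G z) := by
  rw [orbit, ← image_univ, ← iUnion_compactCovering, image_iUnion]
  exact MeasurableSet.iUnion fun n =>
    ((isCompact_compactCovering G n).image hz).isClosed.measurableSet

theorem isOpenPosMeasure_of_isAddLeftInvariant {H : Type*} [AddGroup H] [TopologicalSpace H]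
    [IsTopologicalAddGroup H] [SigmaCompactSpace H] [MeasurableSpace H] [BorelSpace H]
    {ν : Measure H} [ν.IsAddLeftInvariant] (hν : ν ≠ 0) : ν.IsOpenPosMeasure := by
  obtain ⟨n, hn⟩ : ∃ n, ν (compactCovering H n) ≠ 0 := by
    by_contra! hnull
    rw [← measure_iUnion_null_iff, iUnion_compactCovering, Measure.measure_univ_eq_zero] at hnull
    exact hν hnull
  exact isOpenPosMeasure_of_addLeftInvariant_of_compact _ (isCompact_compactCovering H n) hn

variable {G X : Type*} [AddCommGroup G] [AddAction G X] [TopologicalSpace G]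
  [IsTopologicalAddGroup G] [PolishSpace G] [MeasurableSpace G] [BorelSpace G]
  [MeasurableSpace X]

variable (G) in
/-- `m` is the normalized Haar measure of the orbit of `z`: the image of the Haar probability
measure of `G ⧸ stabilizer G z` under the identification of this group with the orbit. -/
def IsOrbitHaar (z : X) (m : Measure X) : Prop :=
  ∃ ν : Measure (G ⧸ stabilizer G z),
    ν.IsAddHaarMeasure ∧ IsProbabilityMeasure ν ∧ m = ν.map (ofQuotientStabilizer G z)

theorem exists_isOrbitHaar {z : X} [IsClosed (stabilizer G z : Set G)]
    [CompactSpace (G ⧸ stabilizer G z)] : ∃ m : Measure X, IsOrbitHaar G z m :=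
  ⟨_, Measure.addHaarMeasure ⊤, inferInstance, ⟨Measure.addHaarMeasure_self⟩, rfl⟩

variable [LocallyCompactSpace G]

theorem IsOrbitHaar.compactSpace {z : X} [IsClosed (stabilizer G z : Set G)] {m : Measure X}
    (hm : IsOrbitHaar G z m) : CompactSpace (G ⧸ stabilizer G z) := by
  obtain ⟨ν, hν, hprob, -⟩ := hm
  by_contra hcompact
  have := not_compactSpace_iff.1 hcompact
  exact ENNReal.one_ne_top (measure_univ (μ := ν) ▸ measure_univ_of_isAddLeftInvariant ν)

variable [TopologicalSpace X] [T2Space X] [SecondCountableTopology X] [BorelSpace X]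

theorem measurableEmbedding_ofQuotientStabilizer {z : X} (hz : Continuous fun g : G => g +ᵥ z) :
    MeasurableEmbedding (ofQuotientStabilizer G z) := by
  refine ⟨injective_ofQuotientStabilizer G z, measurable_from_quotient.2 hz.measurable,
    fun {S} hS => ?_⟩
  have hpre : (fun g : G => g +ᵥ z) ⁻¹' (ofQuotientStabilizer G z '' S) =
      QuotientAddGroup.mk ⁻¹' S := by
    ext g
    exact (injective_ofQuotientStabilizer G z).mem_set_image (a := (g : G ⧸ stabilizer G z))
  have hsub : ofQuotientStabilizer G z '' S ⊆ orbit G z :=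
    range_ofQuotientStabilizer (G := G) z ▸ image_subset_range _ _
  rw [← inter_eq_left.2 hsub, orbit,
    ← hz.measurable.measurableSet_preimage_iff_inter_range (measurableSet_orbit hz), hpre]
  exact measurableSet_quotient.1 hS

theorem isAddLeftInvariant_comap_ofQuotientStabilizer {z : X}
    (hz : Continuous fun g : G => g +ᵥ z) {m : Measure X} [VAddInvariantMeasure G X m] :
    (m.comap (ofQuotientStabilizer G z)).IsAddLeftInvariant := by
  have hF := measurableEmbedding_ofQuotientStabilizer hz
  have : IsClosed (stabilizer G z : Set G) := isClosed_stabilizer hz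
  refine ⟨fun q => ?_⟩
  obtain ⟨g, rfl⟩ := QuotientAddGroup.mk_surjective q
  ext A hA
  have hpre : ((g : G ⧸ stabilizer G z) + ·) ⁻¹' A = (-g) +ᵥ A := by
    ext q
    rw [mem_vadd_set_iff_neg_vadd_mem, neg_neg]
    rfl
  rw [Measure.map_apply (measurable_const_add _) hA, hF.comap_apply, hF.comap_apply, hpre,
    image_vadd_comm _ _ _ (ofQuotientStabilizer_vadd G z (-g)), measure_vadd]

theorem isOrbitHaar_of_measure_orbit_ne_zero {z : X} (hz : Continuous fun g : G => g +ᵥ z)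
    {m : Measure X} [IsFiniteMeasure m] [VAddInvariantMeasure G X m] (hm : m (orbit G z) ≠ 0) :
    IsOrbitHaar G z ((m (orbit G z))⁻¹ • m.restrict (orbit G z)) := by
  have : IsClosed (stabilizer G z : Set G) := isClosed_stabilizer hz
  have hF := measurableEmbedding_ofQuotientStabilizer hz
  have := isAddLeftInvariant_comap_ofQuotientStabilizer hz (m := m)
  set ν := (m (orbit G z))⁻¹ • m.comap (ofQuotientStabilizer G z) with hν
  have hprob : IsProbabilityMeasure ν := ⟨by
    rw [hν, Measure.smul_apply, hF.comap_apply, image_univ, range_ofQuotientStabilizer,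
      smul_eq_mul, ENNReal.inv_mul_cancel hm (measure_ne_top m _)]⟩
  have := isOpenPosMeasure_of_isAddLeftInvariant (IsProbabilityMeasure.ne_zero ν)
  refine ⟨ν, { lt_top_of_isCompact := fun K _ => measure_lt_top ν K }, hprob, ?_⟩
  rw [hν, Measure.map_smul, hF.map_comap, range_ofQuotientStabilizer]

end OrbitMeasure

section ConvexCombination

open AddAction

theorem exists_nat_sum_smul_eq {ι X : Type*} [Countable ι] [Nonempty ι] [MeasurableSpace X]
    (c : ι → ℝ≥0∞) (m : ι → Measure X) :
    ∃ (k : ℕ → ι) (b : ℕ → ℝ≥0∞), ∑' n, b n = ∑' i, c i ∧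
      Measure.sum (fun n => b n • m (k n)) = Measure.sum fun i => c i • m i := by
  obtain ⟨f, hf⟩ := exists_injective_nat ι
  refine ⟨Function.invFun f, Function.extend f c 0, tsum_extend_zero hf c, ?_⟩
  rw [← Measure.sum_extend_zero hf]
  congr 1 with n : 1
  by_cases hn : ∃ i, f i = n
  · obtain ⟨i, rfl⟩ := hn
    rw [hf.extend_apply, hf.extend_apply, Function.leftInverse_invFun hf i]
  · simp only [Function.extend_apply' _ _ _ hn, Pi.zero_apply, zero_smul]

theorem pairwise_disjoint_orbit {G X : Type*} [AddGroup G] [AddAction G X] :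
    Pairwise (Function.onFun Disjoint fun q : orbitRel.Quotient G X => q.orbit) := by
  refine fun q r hqr => Set.disjoint_left.2 fun x hxq hxr => hqr ?_
  rw [orbitRel.Quotient.mem_orbit] at hxq hxr
  exact hxq.symm.trans hxr

/-- The orbits of positive measure. -/
abbrev ChargedOrbit (G : Type*) {X : Type*} [AddGroup G] [AddAction G X] [MeasurableSpace X]
    (m : Measure X) : Type _ :=
  {q : orbitRel.Quotient G X // m q.orbit ≠ 0}

theorem ae_measure_orbit_ne_zero {G X : Type*} [AddGroup G] [AddAction G X] [TopologicalSpace G]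
    [TopologicalSpace X] [SecondCountableTopology X] [MeasurableSpace X] {L : Set X}
    (hL : IsLocallyTransitiveOn G L) {m : Measure X} (hmL : ∀ᵐ x ∂m, x ∈ L) :
    ∀ᵐ x ∂m, m (orbit G x) ≠ 0 := by
  obtain ⟨t, -, ht, hcover⟩ := TopologicalSpace.countable_cover_nhdsWithin
    (f := fun x => orbit G x) fun x hx => hL.orbit_mem_nhdsWithin hx
  have hnull : ∀ᵐ y ∂m, ∀ x ∈ t, y ∈ orbit G x → m (orbit G x) ≠ 0 := by
    refine (ae_ball_iff ht).2 fun x _ => ?_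
    by_cases hx : m (orbit G x) = 0
    · filter_upwards [measure_eq_zero_iff_ae_notMem.1 hx] with y hy hyx using absurd hyx hy
    · exact ae_of_all _ fun _ _ => hx
  filter_upwards [hmL, hnull] with y hyL hy
  obtain ⟨x, hx, hyx⟩ := mem_iUnion₂.1 (hcover hyL)
  exact orbit_eq_iff.2 hyx ▸ hy x hx hyx

theorem measurableSet_quotient_orbit {G X : Type*} [AddGroup G] [AddAction G X]
    [MeasurableSpace X] (hmeas : ∀ x : X, MeasurableSet (orbit G x))
    (q : orbitRel.Quotient G X) : MeasurableSet q.orbit :=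
  q.orbit_eq_orbit_out Quotient.out_eq' ▸ hmeas _

theorem countable_chargedOrbit {G X : Type*} [AddGroup G] [AddAction G X] [MeasurableSpace X]
    (hmeas : ∀ x : X, MeasurableSet (orbit G x)) (m : Measure X) [SFinite m] :
    Countable (ChargedOrbit G m) := by
  have hcount := Measure.countable_meas_pos_of_disjoint_iUnion (μ := m)
    (measurableSet_quotient_orbit (G := G) hmeas) pairwise_disjoint_orbit
  simp only [pos_iff_ne_zero] at hcount
  exact hcount.to_subtype

theorem eq_sum_restrict_chargedOrbit {G X : Type*} [AddGroup G] [AddAction G X]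
    [MeasurableSpace X] (hmeas : ∀ x : X, MeasurableSet (orbit G x)) {m : Measure X} [SFinite m]
    (hcharged : ∀ᵐ x ∂m, m (orbit G x) ≠ 0) :
    m = Measure.sum fun q : ChargedOrbit G m => m.restrict q.1.orbit := by
  have := countable_chargedOrbit hmeas m
  rw [← Measure.restrict_iUnion (pairwise_disjoint_orbit.comp_of_injective Subtype.val_injective)
    fun q => measurableSet_quotient_orbit hmeas q.1, Measure.restrict_eq_self_of_ae_mem]
  filter_upwards [hcharged] with x hx using mem_iUnion.2 ⟨⟨⟦x⟧, hx⟩, mem_orbit_self x⟩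

theorem exists_mem_chargedOrbit_eq {G X : Type*} [AddGroup G] [AddAction G X] [MeasurableSpace X]
    {m : Measure X} {L : Set X} (hmL : ∀ᵐ x ∂m, x ∈ L) (q : ChargedOrbit G m) :
    ∃ x ∈ L, q.1.orbit = orbit G x := by
  obtain ⟨x, hxq, hxL⟩ : ∃ x ∈ q.1.orbit, x ∈ L := by
    by_contra! hne
    exact q.2 (measure_mono_null hne hmL)
  rw [orbitRel.Quotient.mem_orbit] at hxq
  exact ⟨x, hxL, by rw [← hxq]; rfl⟩

theorem exists_isOrbitHaar_sum_eq {G X : Type*} [AddCommGroup G] [AddAction G X]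
    [TopologicalSpace G] [IsTopologicalAddGroup G] [PolishSpace G] [LocallyCompactSpace G]
    [MeasurableSpace G] [BorelSpace G] [TopologicalSpace X] [T2Space X]
    [SecondCountableTopology X] [MeasurableSpace X] [BorelSpace X]
    (hcont : ∀ x : X, Continuous fun g : G => g +ᵥ x) {L : Set X}
    (hL : IsLocallyTransitiveOn G L) {m : Measure X} [IsProbabilityMeasure m]
    [VAddInvariantMeasure G X m] (hmL : ∀ᵐ x ∂m, x ∈ L) :
    ∃ (z : ℕ → X) (c : ℕ → ℝ≥0∞) (τ : ℕ → Measure X), (∀ n, z n ∈ L) ∧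
      (∀ n, IsOrbitHaar G (z n) (τ n)) ∧ ∑' n, c n = 1 ∧ m = Measure.sum fun n => c n • τ n := by
  have hmeas : ∀ x : X, MeasurableSet (orbit G x) := fun x => measurableSet_orbit (hcont x)
  have hcharged := ae_measure_orbit_ne_zero hL hmL
  have := countable_chargedOrbit hmeas m
  have : Nonempty (ChargedOrbit G m) := hcharged.exists.elim fun x hx => ⟨⟦x⟧, hx⟩
  choose x hxL hx using exists_mem_chargedOrbit_eq (G := G) hmL
  have hpos : ∀ q, m (orbit G (x q)) ≠ 0 := fun q => hx q ▸ q.2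
  have hsum : m = Measure.sum fun q => m.restrict (orbit G (x q)) := by
    simpa only [hx] using eq_sum_restrict_chargedOrbit hmeas hcharged
  have htotal : ∑' q, m (orbit G (x q)) = 1 := by
    rw [← measure_univ (μ := m)]
    conv_rhs => rw [hsum]
    simp only [Measure.sum_apply _ MeasurableSet.univ, Measure.restrict_apply_univ]
  obtain ⟨k, c, hc, hk⟩ := exists_nat_sum_smul_eq (fun q => m (orbit G (x q)))
    fun q => (m (orbit G (x q)))⁻¹ • m.restrict (orbit G (x q))
  refine ⟨fun n => x (k n), c, _, fun n => hxL (k n), fun n =>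
    isOrbitHaar_of_measure_orbit_ne_zero (hcont _) (hpos (k n)), hc.trans htotal, ?_⟩
  rw [hk]
  simp only [smul_smul, ENNReal.mul_inv_cancel (hpos _) (measure_ne_top m _), one_smul]
  exact hsum

end ConvexCombination

section NullSets

open scoped Pointwise

theorem measure_eq_zero_of_eventually_disjoint_vadd {G A X : Type*} [AddGroup G] [AddAction G X]
    [MeasurableSpace X] {μ : Measure X} [IsFiniteMeasure μ] [MeasurableConstVAdd G X]
    [VAddInvariantMeasure G X μ] [AddGroup A] [TopologicalSpace A] [IsTopologicalAddGroup A]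
    [T1Space A] [(𝓝[≠] (0 : A)).NeBot] (i : A →+ G) {C : Set X} (hC : MeasurableSet C)
    (hdisj : ∀ᶠ t in 𝓝[≠] (0 : A), Disjoint (i t +ᵥ C) C) : μ C = 0 := by
  obtain ⟨T, hT, hTsub⟩ := exists_nhds_half_neg (eventually_nhdsWithin_iff.1 hdisj)
  have : Infinite T := (infinite_of_mem_nhds 0 hT).to_subtype
  have hmeas : ∀ t : T, NullMeasurableSet (-i t +ᵥ C) μ := fun t =>
    (hC.const_vadd _).nullMeasurableSet
  by_contra hne
  obtain ⟨s, t, hst, y, hys, hyt⟩ := exists_nonempty_inter_of_measure_univ_lt_tsum_measure μ hmeas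
    (by simpa only [measure_vadd, ENNReal.tsum_const_eq_top_of_ne_zero hne] using
      measure_lt_top μ univ)
  rw [mem_vadd_set_iff_neg_vadd_mem, neg_neg] at hys hyt
  refine (hTsub s s.2 t t.2 (sub_ne_zero.2 (Subtype.coe_injective.ne hst))).le_bot
    ⟨⟨_, hyt, ?_⟩, hys⟩
  beta_reduce
  rw [map_sub, ← add_vadd, sub_add_cancel]

end NullSets

section ConditionalDistribution

open ProbabilityTheory

theorem ae_measurePreserving_condDistrib {α β : Type*} [MeasurableSpace α] [StandardBorelSpace α]
    [Nonempty α] [MeasurableSpace β] {μ : Measure α} [IsFiniteMeasure μ] {Φ : α → β}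
    (hΦ : Measurable Φ) {T : α → α} (hT : MeasurePreserving T μ μ) (hΦT : ∀ x, Φ (T x) = Φ x) :
    ∀ᵐ b ∂(μ.map Φ), MeasurePreserving T (condDistrib id Φ μ b) (condDistrib id Φ μ b) := by
  have hid : condDistrib id Φ μ =ᵐ[μ.map Φ] condDistrib (T ∘ id) Φ μ := by
    refine condDistrib_ae_eq_of_measure_eq_compProd Φ aemeasurable_id ?_
    rw [compProd_map_condDistrib (hT.measurable.comp measurable_id).aemeasurable]
    conv_lhs => rw [← hT.map_eq]
    rw [Measure.map_map (hΦ.prodMk measurable_id) hT.measurable]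
    simp only [Function.comp_def, hΦT, id]
  filter_upwards [hid, condDistrib_comp (mβ := inferInstance) Φ (Y := id) (μ := μ) aemeasurable_id
    hT.measurable] with b hb hcomp
  refine ⟨hT.measurable, ?_⟩
  rw [hcomp, Kernel.map_apply _ hT.measurable] at hb
  exact hb.symm

theorem measurePreserving_of_dense {α P : Type*} [TopologicalSpace α] [MeasurableSpace α]
    [BorelSpace α] [HasOuterApproxClosed α] [TopologicalSpace P] [FirstCountableTopology P]
    {m : Measure α} [IsFiniteMeasure m] {T : P → α → α} (hT : ∀ t, Measurable (T t))
    (hcont : ∀ x, Continuous fun t => T t x) {D : Set P} (hD : Dense D)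
    (hinv : ∀ t ∈ D, MeasurePreserving (T t) m m) (t : P) : MeasurePreserving (T t) m m := by
  refine ⟨hT t, ?_⟩
  have : IsFiniteMeasure (m.map (T t)) := Measure.isFiniteMeasure_map m _
  refine ext_of_forall_integral_eq_of_IsFiniteMeasure fun g => ?_
  have hmap : ∀ t, ∫ x, g x ∂(m.map (T t)) = ∫ x, g (T t x) ∂m := fun t =>
    integral_map (hT t).aemeasurable g.continuous.aestronglyMeasurable
  have hcontg : Continuous fun t => ∫ x, g (T t x) ∂m :=
    continuous_of_dominated (bound := fun _ => ‖g‖)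
      (fun t => (g.continuous.measurable.comp (hT t)).aestronglyMeasurable)
      (fun t => ae_of_all _ fun x => g.norm_coe_le_norm _) (integrable_const _)
      (ae_of_all _ fun x => g.continuous.comp (hcont x))
  have heq : (fun t => ∫ x, g (T t x) ∂m) = fun _ => ∫ x, g x ∂m :=
    hcontg.ext_on hD continuous_const fun s hs => by
      beta_reduce
      rw [← hmap, (hinv s hs).map_eq]
  rw [hmap]
  exact congrFun heq t

theorem ae_vaddInvariantMeasure_condDistrib {G X β : Type*} [AddMonoid G] [AddAction G X]
    [TopologicalSpace G] [SecondCountableTopology G] [TopologicalSpace X] [PolishSpace X]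
    [HasOuterApproxClosed X] [MeasurableSpace X] [BorelSpace X] [Nonempty X] [MeasurableSpace β]
    [MeasurableConstVAdd G X]
    (hcont : ∀ x : X, Continuous fun g : G => g +ᵥ x) {μ : Measure X} [IsFiniteMeasure μ]
    [VAddInvariantMeasure G X μ] {Φ : X → β} (hΦ : Measurable Φ)
    (hΦG : ∀ (g : G) x, Φ (g +ᵥ x) = Φ x) :
    ∀ᵐ b ∂(μ.map Φ), VAddInvariantMeasure G X (condDistrib id Φ μ b) := by
  obtain ⟨D, hDc, hDd⟩ := TopologicalSpace.exists_countable_dense G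
  filter_upwards [(ae_ball_iff hDc).2 fun g _ =>
    ae_measurePreserving_condDistrib hΦ (measurePreserving_vadd g μ) (hΦG g)] with b hb
  exact ⟨fun g _ hs => (measurePreserving_of_dense (fun g => measurable_const_vadd g) hcont hDd hb
    g).measure_preimage hs.nullMeasurableSet⟩

theorem ae_ae_condDistrib_id {α β : Type*} [MeasurableSpace α] [StandardBorelSpace α]
    [Nonempty α] [MeasurableSpace β] [MeasurableEq β] {μ : Measure α} [IsFiniteMeasure μ]
    {Φ : α → β} (hΦ : Measurable Φ) {R : Set α} (hR : MeasurableSet R) (hμR : ∀ᵐ x ∂μ, x ∈ R) :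
    ∀ᵐ b ∂(μ.map Φ), ∀ᵐ x ∂(condDistrib id Φ μ b), x ∈ R ∧ Φ x = b := by
  have hmeas : MeasurableSet {q : β × α | q.2 ∈ R ∧ Φ q.2 = q.1} :=
    (measurable_snd hR).inter (measurableSet_eq_fun (hΦ.comp measurable_snd) measurable_fst)
  refine Measure.ae_ae_of_ae_compProd (p := fun q : β × α => q.2 ∈ R ∧ Φ q.2 = q.1) ?_
  rw [compProd_map_condDistrib aemeasurable_id,
    ae_map_iff (hΦ.prodMk measurable_id).aemeasurable hmeas]
  filter_upwards [hμR] with x hx using ⟨hx, rfl⟩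

theorem integral_condDistrib_id {α β E : Type*} [MeasurableSpace α] [StandardBorelSpace α]
    [Nonempty α] [MeasurableSpace β] [NormedAddCommGroup E] [NormedSpace ℝ E]
    {μ : Measure α} [IsFiniteMeasure μ] {Φ : α → β} (hΦ : Measurable Φ) {a : α → E}
    (ha : Integrable a μ) :
    Integrable (fun b => ∫ x, a x ∂(condDistrib id Φ μ b)) (μ.map Φ) ∧
      ∫ x, a x ∂μ = ∫ b, ∫ x, a x ∂(condDistrib id Φ μ b) ∂(μ.map Φ) := by
  have hpair : Measurable fun x => (Φ x, id x) := hΦ.prodMk measurable_id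
  have hsnd : (μ.map fun x => (Φ x, id x)).map Prod.snd = μ :=
    (Measure.map_map measurable_snd hpair).trans Measure.map_id
  have hint : Integrable (fun q : β × α => a q.2) (μ.map fun x => (Φ x, id x)) :=
    Integrable.comp_measurable (g := a) (by rwa [hsnd]) measurable_snd
  refine ⟨hint.integral_condDistrib_map aemeasurable_id, ?_⟩
  have hfubini := Measure.integral_compProd (μ := μ.map Φ) (κ := condDistrib id Φ μ)
    (f := fun q : β × α => a q.2) (by rwa [compProd_map_condDistrib aemeasurable_id])
  rw [← hfubini, compProd_map_condDistrib aemeasurable_id, integral_map hpair.aemeasurable hint.1]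
  rfl

end ConditionalDistribution

section ParametricIntegral

open Function

variable {E : Type*} [NormedAddCommGroup E] [NormedSpace ℝ E] {g : ℝ → ℝ → E}

theorem hasDerivAt_fst_of_contDiff (hg : ContDiff ℝ 1 (uncurry g)) (q s : ℝ) :
    HasDerivAt (fun q => g q s) (fderiv ℝ (uncurry g) (q, s) (1, 0)) q := by
  have hfderiv := ((hg.differentiable one_ne_zero) (q, s)).hasFDerivAt
  exact hfderiv.comp_hasDerivAt q ((hasDerivAt_id q).prodMk (hasDerivAt_const q s))

theorem contDiff_deriv_fst {n : ℕ} (hg : ContDiff ℝ (n + 1 : ℕ) (uncurry g)) :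
    ContDiff ℝ n (uncurry fun q s => deriv (fun q => g q s) q) := by
  have hg₁ : ContDiff ℝ 1 (uncurry g) := hg.of_le (by exact_mod_cast Nat.le_add_left 1 n)
  have hpartial : (uncurry fun q s => deriv (fun q => g q s) q) =
      fun p => fderiv ℝ (uncurry g) p (1, 0) :=
    funext fun p => (hasDerivAt_fst_of_contDiff hg₁ p.1 p.2).deriv
  rw [hpartial]
  exact (hg.fderiv_right (m := n) (by norm_cast)).clm_apply contDiff_const

theorem hasDerivAt_intervalIntegral_of_contDiff (hg : ContDiff ℝ 1 (uncurry g)) (a b x : ℝ) :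
    HasDerivAt (fun q => ∫ s in a..b, g q s) (∫ s in a..b, deriv (fun q => g q s) x) x := by
  have hd : Continuous fun p => fderiv ℝ (uncurry g) p (1, 0) :=
    (hg.continuous_fderiv one_ne_zero).clm_apply continuous_const
  obtain ⟨C, hC⟩ := ((isCompact_closedBall x 1).prod (isCompact_uIcc (a := a) (b := b)))
    |>.exists_bound_of_continuousOn hd.continuousOn
  have hslice (q : ℝ) : Continuous (Prod.mk q : ℝ → ℝ × ℝ) := by fun_prop
  have hint := intervalIntegral.hasDerivAt_integral_of_dominated_loc_of_deriv_le (μ := volume)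
    (F := g) (F' := fun q s => fderiv ℝ (uncurry g) (q, s) (1, 0)) (bound := fun _ => C)
    (Metric.ball_mem_nhds x one_pos)
    (Eventually.of_forall fun q => (hg.continuous.comp (hslice q)).aestronglyMeasurable)
    ((hg.continuous.comp (hslice x)).intervalIntegrable a b)
    (hd.comp (hslice x)).aestronglyMeasurable
    (Eventually.of_forall fun s hs q hq =>
      hC (q, s) ⟨Metric.ball_subset_closedBall hq, uIoc_subset_uIcc hs⟩)
    intervalIntegrable_const
    (Eventually.of_forall fun s _ q _ => hasDerivAt_fst_of_contDiff hg q s)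
  simpa only [(hasDerivAt_fst_of_contDiff hg x _).deriv] using hint.2

theorem contDiff_intervalIntegral {n : ℕ} (hg : ContDiff ℝ n (uncurry g)) (a b : ℝ) :
    ContDiff ℝ n fun q => ∫ s in a..b, g q s := by
  induction n generalizing g with
  | zero =>
    exact contDiff_zero.2 <| intervalIntegral.continuous_parametric_intervalIntegral_of_continuous'
      (contDiff_zero.1 hg) a b
  | succ n ih =>
    have hderiv := hasDerivAt_intervalIntegral_of_contDiff
      (hg.of_le (by exact_mod_cast Nat.le_add_left 1 n)) a b
    rw [Nat.cast_add, Nat.cast_one, contDiff_succ_iff_deriv, funext fun q => (hderiv q).deriv]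
    exact ⟨fun q => (hderiv q).differentiableAt, by simp, ih (contDiff_deriv_fst hg)⟩

end ParametricIntegral

theorem exists_lipschitzWith_of_periodic {E : Type*} [NormedAddCommGroup E] [NormedSpace ℝ E]
    {f : ℝ → E} {l : ℝ} (hf : ContDiff ℝ 1 f) (hl : 0 < l) (hper : Function.Periodic f l) :
    ∃ K, LipschitzWith K f := by
  have hderiv : Function.Periodic (deriv f) l := fun x => by
    rw [← deriv_comp_add_const, funext hper]
  obtain ⟨C, hC⟩ := (isCompact_Icc (a := 0) (b := l)).exists_bound_of_continuousOn
    (hf.continuous_deriv le_rfl).continuousOn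
  refine ⟨C.toNNReal, lipschitzWith_of_nnnorm_deriv_le (hf.differentiable one_ne_zero) fun x => ?_⟩
  obtain ⟨y, hy, hxy⟩ := hderiv.exists_mem_Ico₀ hl x
  rw [hxy, ← NNReal.coe_le_coe, coe_nnnorm]
  exact (hC y (Ico_subset_Icc_self hy)).trans (Real.le_coe_toNNReal C)

section CompleteFields

open scoped Manifold

variable {E : Type*} [NormedAddCommGroup E] [NormedSpace ℝ E] {v : E → E} {K : ℝ≥0}
  {γ δ : ℝ → E}

theorem isIntegralCurve_unique (hv : LipschitzWith K v) (hγ : IsIntegralCurve γ fun _ => v)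
    (hδ : IsIntegralCurve δ fun _ => v) {t₀ : ℝ} (h : γ t₀ = δ t₀) : γ = δ :=
  ODE_solution_unique_univ (s := fun _ => univ) (fun _ => hv.lipschitzOnWith)
    (fun t => ⟨hγ t, mem_univ _⟩) (fun t => ⟨hδ t, mem_univ _⟩) h

theorem eq_zero_of_isIntegralCurve (hv : LipschitzWith K v) (hγ : IsIntegralCurve γ fun _ => v)
    {t : ℝ} (ht : v (γ t) = 0) (s : ℝ) : v (γ s) = 0 := by
  have hconst : IsIntegralCurve (fun _ => γ t) fun _ => v := isIntegralCurve_const fun _ => ht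
  rw [isIntegralCurve_unique hv hγ hconst (t₀ := t) rfl, ht]

variable [CompleteSpace E]

/-- For a Lipschitz field the existence time in the Picard–Lindelöf theorem can be chosen
independently of the initial point: `v` is at most `2 ‖v y‖` on the ball of radius
`‖v y‖ / (K + 1)` around `y`. -/
theorem exists_hasDerivAt_Ioo_of_lipschitzWith (hv : LipschitzWith K v) (y : E) :
    ∃ α : ℝ → E, α 0 = y ∧
      ∀ t ∈ Ioo (-(1 / (2 * (K + 1)) : ℝ)) (1 / (2 * (K + 1))), HasDerivAt α (v (α t)) t := by
  set ε : ℝ := 1 / (2 * (K + 1)) with hε_def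
  have hε : 0 < ε := by positivity
  have hpl : IsPicardLindelof (fun _ => v) (tmin := -ε) (tmax := ε) ⟨0, by simp [hε.le]⟩ y
      (‖v y‖₊ / (K + 1)) 0 (2 * ‖v y‖₊) K := by
    refine .of_time_independent (fun z hz => ?_) hv.lipschitzOnWith ?_
    · have hzy : ‖z - y‖ ≤ ‖v y‖ / (K + 1) := by simpa [dist_eq_norm] using hz
      have hK : (K : ℝ) * (‖v y‖ / (K + 1)) ≤ ‖v y‖ := by
        rw [← mul_div_assoc, div_le_iff₀ (by positivity)]
        nlinarith [norm_nonneg (v y)]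
      calc ‖v z‖ ≤ ‖v z - v y‖ + ‖v y‖ := norm_le_norm_sub_add _ _
        _ ≤ K * (‖v y‖ / (K + 1)) + ‖v y‖ := by
          gcongr
          exact (hv.norm_sub_le z y).trans (by gcongr)
        _ ≤ ↑(2 * ‖v y‖₊) := by
          push_cast
          linarith
    · simp only [sub_zero, zero_sub, neg_neg, max_self, hε_def]
      push_cast
      apply le_of_eq
      field_simp
      simp
  obtain ⟨α, hα₀, hα⟩ := hpl.exists_eq_forall_mem_Icc_hasDerivWithinAt₀
  exact ⟨α, hα₀, fun t ht => (hα t (Ioo_subset_Icc_self ht)).hasDerivAt (Icc_mem_nhds ht.1 ht.2)⟩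

theorem exists_isIntegralCurve_of_lipschitzWith (hv : ContDiff ℝ 1 v) (hK : LipschitzWith K v)
    (x : E) : ∃ γ : ℝ → E, γ 0 = x ∧ IsIntegralCurve γ fun _ => v := by
  have hsmooth : ContMDiff 𝓘(ℝ, E) 𝓘(ℝ, E).tangent 1
      (fun x : E => (⟨x, v x⟩ : TangentBundle 𝓘(ℝ, E) E)) :=
    contMDiff_vectorSpace_iff_contDiff.2 hv
  obtain ⟨γ, hγ₀, hγ⟩ := exists_isMIntegralCurve_of_isMIntegralCurveOn (v := v) hsmooth
    (ε := 1 / (2 * (K + 1))) (by positivity) (fun y => by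
      obtain ⟨α, hα₀, hα⟩ := exists_hasDerivAt_Ioo_of_lipschitzWith hK y
      exact ⟨α, hα₀, fun t ht => (hα t ht).hasFDerivAt.hasMFDerivAt.hasMFDerivWithinAt⟩) x
  exact ⟨γ, hγ₀, fun t => hasDerivAt_iff_hasFDerivAt.2 (hasMFDerivAt_iff_hasFDerivAt.1 (hγ t))⟩

end CompleteFields

section NewtonEquation

theorem exists_mem_nhds_injOn_of_hasStrictDerivAt {𝕜 : Type*} [NontriviallyNormedField 𝕜]
    [CompleteSpace 𝕜] {g : 𝕜 → 𝕜} {g' a : 𝕜} (hg : HasStrictDerivAt g g' a) (hg' : g' ≠ 0) :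
    ∃ N ∈ 𝓝 a, InjOn g N :=
  ⟨_, (hg.hasStrictFDerivAt_equiv hg').eventually_left_inverse, LeftInvOn.injOn fun _ hx => hx⟩

/-- Since `p ∘ γ` is open at `t₀`, every value of `p` near `p (γ t₀)` is taken on the curve, and
near `γ t₀` the values of `p` and `E` determine the point. -/
theorem eventually_mem_image_of_hasStrictDerivAt {𝕜 X Y : Type*} [NontriviallyNormedField 𝕜]
    [CompleteSpace 𝕜] [TopologicalSpace X] {γ : 𝕜 → X} {p : X → 𝕜} {E : X → Y} {p' t₀ : 𝕜}
    (hγ : ContinuousAt γ t₀) (hp : ContinuousAt p (γ t₀)) (hE : ∀ t, E (γ t) = E (γ t₀))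
    (hpγ : HasStrictDerivAt (p ∘ γ) p' t₀) (hp' : p' ≠ 0) {N : Set X} (hN : N ∈ 𝓝 (γ t₀))
    (hinj : InjOn (fun x => (p x, E x)) N) {T : Set 𝕜} (hT : T ∈ 𝓝 t₀) :
    ∀ᶠ x in 𝓝 (γ t₀), E x = E (γ t₀) → x ∈ γ '' T := by
  have himage : p ∘ γ '' (T ∩ γ ⁻¹' N) ∈ 𝓝 (p (γ t₀)) := by
    rw [← Function.comp_apply (f := p), ← hpγ.map_nhds_eq hp']
    exact image_mem_map (inter_mem hT (hγ hN))
  filter_upwards [hp himage, hN] with x ⟨t, ⟨htT, htN⟩, ht⟩ hxN hx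
  exact ⟨t, htT, hinj htN hxN (Prod.ext ht ((hE t).trans hx.symm))⟩

/-- The vector field of Newton's equation `q' = η`, `η' = -f(q)` in the state space of the
pairs `(q, η)`. -/
def newtonField (f : ℝ → ℝ) (x : ℝ × ℝ) : ℝ × ℝ := (x.2, -f x.1)

/-- The energy `η² / 2 + W(q)` of the state `(q, η)`. -/
def newtonEnergy (W : ℝ → ℝ) (x : ℝ × ℝ) : ℝ := x.2 ^ 2 / 2 + W x.1

variable {W f : ℝ → ℝ} {γ : ℝ → ℝ × ℝ}

theorem newtonField_ne_zero_iff {x : ℝ × ℝ} : newtonField f x ≠ 0 ↔ x.2 ≠ 0 ∨ f x.1 ≠ 0 := by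
  simp [newtonField, Prod.ext_iff, ← not_and_or]

theorem contDiff_newtonField {n : WithTop ℕ∞} (hf : ContDiff ℝ n f) :
    ContDiff ℝ n (newtonField f) := by
  unfold newtonField
  fun_prop

theorem lipschitzWith_newtonField {K : ℝ≥0} (hf : LipschitzWith K f) :
    LipschitzWith (max 1 K) (newtonField f) := by
  unfold newtonField
  simpa using LipschitzWith.prod_snd.prodMk (hf.comp LipschitzWith.prod_fst).neg

theorem newtonEnergy_eq_of_isIntegralCurve (hW : ∀ q, HasDerivAt W (f q) q)
    (hγ : IsIntegralCurve γ fun _ => newtonField f) (s t : ℝ) :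
    newtonEnergy W (γ s) = newtonEnergy W (γ t) := by
  have hderiv (t : ℝ) : HasDerivAt (fun t => newtonEnergy W (γ t)) 0 t := by
    have hq : HasDerivAt (fun t => (γ t).1) (γ t).2 t := (hγ t).fst
    have hη : HasDerivAt (fun t => (γ t).2) (-f (γ t).1) t := (hγ t).snd
    convert! ((hη.pow 2).div_const 2).add ((hW (γ t).1).comp t hq) using 1
    simp only [Nat.cast_ofNat, Nat.add_one_sub_one, pow_one]
    ring
  exact is_const_of_deriv_eq_zero (fun t => (hderiv t).differentiableAt)
    (fun t => (hderiv t).deriv) s t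

theorem injOn_fst_newtonEnergy (c : ℝ) :
    InjOn (fun x => (x.1, newtonEnergy W x)) {x : ℝ × ℝ | 0 < x.2 * c} := by
  rintro ⟨q, η⟩ hx ⟨q', η'⟩ hx' h
  simp only [Prod.mk.injEq] at h
  obtain ⟨rfl, hE⟩ := h
  have hsq : η ^ 2 = η' ^ 2 := by
    simp only [newtonEnergy] at hE
    linarith
  rcases sq_eq_sq_iff_eq_or_eq_neg.1 hsq with rfl | rfl
  · rfl
  · simp only [mem_ofPred] at hx hx'
    linarith

theorem injOn_snd_newtonEnergy {N : Set ℝ} (hN : InjOn W N) :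
    InjOn (fun x => (x.2, newtonEnergy W x)) (Prod.fst ⁻¹' N) := by
  rintro ⟨q, η⟩ hx ⟨q', η'⟩ hx' h
  simp only [newtonEnergy, Prod.mk.injEq] at h
  obtain ⟨rfl, hE⟩ := h
  exact Prod.ext (hN hx hx' (add_left_cancel hE)) rfl

theorem eventually_mem_image_of_newtonEnergy_eq (hW : ∀ q, HasDerivAt W (f q) q)
    (hf : Continuous f) (hγ : IsIntegralCurve γ fun _ => newtonField f) {t₀ : ℝ}
    (hne : newtonField f (γ t₀) ≠ 0) {T : Set ℝ} (hT : T ∈ 𝓝 t₀) :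
    ∀ᶠ x in 𝓝 (γ t₀), newtonEnergy W x = newtonEnergy W (γ t₀) → x ∈ γ '' T := by
  have hcont : Continuous γ := hγ.continuous
  have hE (t : ℝ) := newtonEnergy_eq_of_isIntegralCurve hW hγ t t₀
  rcases newtonField_ne_zero_iff.1 hne with hη | hforce
  · have hN : {x : ℝ × ℝ | 0 < x.2 * (γ t₀).2} ∈ 𝓝 (γ t₀) :=
      (isOpen_lt continuous_const (by fun_prop)).mem_nhds (mul_self_pos.2 hη)
    exact eventually_mem_image_of_hasStrictDerivAt (p := Prod.fst) hcont.continuousAt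
      continuousAt_fst hE
      (hasStrictDerivAt_of_hasDerivAt_of_continuousAt (f' := fun t => (γ t).2)
        (.of_forall fun t => (hγ t).fst) (by fun_prop)) hη hN (injOn_fst_newtonEnergy _) hT
  · obtain ⟨N, hN, hinj⟩ := exists_mem_nhds_injOn_of_hasStrictDerivAt
      (hasStrictDerivAt_of_hasDerivAt_of_continuousAt (.of_forall hW) hf.continuousAt) hforce
    exact eventually_mem_image_of_hasStrictDerivAt (p := Prod.snd) hcont.continuousAt
      continuousAt_snd hE
      (hasStrictDerivAt_of_hasDerivAt_of_continuousAt (f' := fun t => -f (γ t).1)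
        (.of_forall fun t => (hγ t).snd) (by fun_prop)) (neg_ne_zero.2 hforce)
      (continuousAt_fst hN) (injOn_snd_newtonEnergy hinj) hT

end NewtonEquation

section Frame

theorem continuous_toTorus : Continuous toTorus :=
  continuous_pi fun i => (AddCircle.continuous_mk' 1).comp (by fun_prop)

theorem isOpenMap_toTorus : IsOpenMap toTorus := by
  have hmk : IsOpenMap fun (y : Fin 2 → ℝ) (i : Fin 2) => (y i : UnitAddCircle) :=
    .piMap (fun _ => QuotientAddGroup.isOpenMap_coe) (by simp)
  exact hmk.comp (EuclideanSpace.equiv (Fin 2) ℝ).toHomeomorph.isOpenMap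

theorem toTorus_surjective : Function.Surjective toTorus := fun x => by
  choose y hy using fun i => QuotientAddGroup.mk_surjective (x i)
  exact ⟨WithLp.toLp 2 y, funext hy⟩

theorem toTorus_add (x y : Plane) : toTorus (x + y) = toTorus x + toTorus y := by
  funext i
  simp [toTorus]

theorem toTorus_eq_iff {x y : Plane} : toTorus x = toTorus y ↔ ∃ k, x = y + vec k := by
  constructor
  · intro h
    have hcoord (i : Fin 2) : ∃ k : ℤ, x i - y i = k := by
      obtain ⟨k, hk⟩ := AddSubgroup.mem_zmultiples_iff.1
        (QuotientAddGroup.eq_iff_sub_mem.1 (congrFun h i))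
      exact ⟨k, by simpa using hk.symm⟩
    choose k hk using hcoord
    refine ⟨k, PiLp.ext fun i => ?_⟩
    fin_cases i <;> simpa [vec, sub_eq_iff_eq_add'] using hk _
  · rintro ⟨k, rfl⟩
    funext i
    fin_cases i <;> simp [toTorus, vec]

theorem toTorus_add_vec (y : Plane) (k : Fin 2 → ℤ) : toTorus (y + vec k) = toTorus y :=
  toTorus_eq_iff.2 ⟨k, rfl⟩

/-- The unit vector `𝔢_Λ / L_Λ`. -/
def unitPar (e : Fin 2 → ℤ) : Plane := (1 / len e) • vec e

/-- The unit vector `𝔢_Λ^⊥ / L_Λ`. -/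
def unitPerp (e : Fin 2 → ℤ) : Plane := (1 / len e) • perp e

/-- The linear coordinates of the plane in the orthonormal frame `(𝔢_Λ^⊥ / L_Λ, 𝔢_Λ / L_Λ)`. -/
def frame (e : Fin 2 → ℤ) : ℝ × ℝ →L[ℝ] Plane :=
  (ContinuousLinearMap.fst ℝ ℝ ℝ).smulRight (unitPerp e) +
    (ContinuousLinearMap.snd ℝ ℝ ℝ).smulRight (unitPar e)

variable {e : Fin 2 → ℤ}

theorem frame_apply (x : ℝ × ℝ) : frame e x = x.1 • unitPerp e + x.2 • unitPar e := rfl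

theorem vec_eq_zero_iff : vec e = 0 ↔ e = 0 := by
  simp [funext_iff, vec, Fin.forall_fin_two]

theorem len_pos (he : e ≠ 0) : 0 < len e := norm_pos_iff.2 (vec_eq_zero_iff.not.2 he)

theorem len_sq (e : Fin 2 → ℤ) : len e ^ 2 = (e 0 : ℝ) ^ 2 + (e 1 : ℝ) ^ 2 := by
  rw [len, EuclideanSpace.norm_sq_eq]
  simp [vec, Fin.sum_univ_two]

theorem len_smul_unitPar (he : e ≠ 0) : len e • unitPar e = vec e := by
  rw [unitPar, smul_smul, mul_one_div_cancel (len_pos he).ne', one_smul]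

theorem len_smul_unitPerp (he : e ≠ 0) : len e • unitPerp e = vec ![-e 1, e 0] := by
  rw [unitPerp, smul_smul, mul_one_div_cancel (len_pos he).ne', one_smul]
  simp [perp, vec]

theorem inner_unitPar (y : Plane) :
    inner ℝ y (unitPar e) = (y 0 * e 0 + y 1 * e 1) / len e := by
  simp only [unitPar, vec, inner_smul_right, PiLp.inner_apply, RCLike.inner_apply,
    Real.ringHom_apply, Fin.sum_univ_two, Matrix.cons_val_zero, Matrix.cons_val_one,
    Matrix.cons_val_fin_one]
  ring

theorem inner_unitPerp (y : Plane) :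
    inner ℝ y (unitPerp e) = (y 1 * e 0 - y 0 * e 1) / len e := by
  simp only [unitPerp, perp, inner_smul_right, PiLp.inner_apply, RCLike.inner_apply,
    Real.ringHom_apply, Fin.sum_univ_two, Matrix.cons_val_zero, Matrix.cons_val_one,
    Matrix.cons_val_fin_one]
  ring

theorem frame_apply_zero (x : ℝ × ℝ) : frame e x 0 = (x.2 * e 0 - x.1 * e 1) / len e := by
  simp only [frame_apply, unitPerp, perp, unitPar, vec, PiLp.add_apply, PiLp.smul_apply,
    Matrix.cons_val_zero, smul_eq_mul]
  ring

theorem frame_apply_one (x : ℝ × ℝ) : frame e x 1 = (x.1 * e 0 + x.2 * e 1) / len e := by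
  simp only [frame_apply, unitPerp, perp, unitPar, vec, PiLp.add_apply, PiLp.smul_apply,
    Matrix.cons_val_one, Matrix.cons_val_fin_one, smul_eq_mul]
  ring

theorem inner_frame_unitPar (he : e ≠ 0) (x : ℝ × ℝ) : inner ℝ (frame e x) (unitPar e) = x.2 := by
  have hlen := (len_pos he).ne'
  rw [inner_unitPar, frame_apply_zero, frame_apply_one]
  field_simp
  rw [len_sq]
  ring

theorem inner_frame_unitPerp (he : e ≠ 0) (x : ℝ × ℝ) :
    inner ℝ (frame e x) (unitPerp e) = x.1 := by
  have hlen := (len_pos he).ne'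
  rw [inner_unitPerp, frame_apply_zero, frame_apply_one]
  field_simp
  rw [len_sq]
  ring

theorem frame_inner (he : e ≠ 0) (y : Plane) :
    frame e (inner ℝ y (unitPerp e), inner ℝ y (unitPar e)) = y := by
  have hlen := (len_pos he).ne'
  ext i
  fin_cases i
  · simp only [Fin.zero_eta, frame_apply_zero, inner_unitPar, inner_unitPerp]
    field_simp
    rw [len_sq]
    ring
  · simp only [Fin.mk_one, frame_apply_one, inner_unitPar, inner_unitPerp]
    field_simp
    rw [len_sq]
    ring

theorem unitPar_ne_zero (he : e ≠ 0) : unitPar e ≠ 0 :=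
  smul_ne_zero (one_div_ne_zero (len_pos he).ne') (vec_eq_zero_iff.not.2 he)

/-- The coordinates `p = ((s, σ), (q, η))` on phase space in which `(s, q)` are the coordinates of
the position and `(σ, η)` those of the momentum in the frame `(𝔢_Λ^⊥ / L_Λ, 𝔢_Λ / L_Λ)`. The flow
of `p_Λ` moves only the state `(q, η)`, by Newton's equation. -/
def phasePoint (e : Fin 2 → ℤ) (p : (ℝ × ℝ) × (ℝ × ℝ)) : Phase :=
  (toTorus (frame e (p.1.1, p.2.1)), frame e (p.1.2, p.2.2))

theorem continuous_phasePoint : Continuous (phasePoint e) :=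
  (continuous_toTorus.comp (by fun_prop)).prodMk (by fun_prop)

theorem frame_surjective (he : e ≠ 0) : Function.Surjective (frame e) :=
  fun y => ⟨_, frame_inner he y⟩

theorem phasePoint_surjective (he : e ≠ 0) : Function.Surjective (phasePoint e) :=
  ((toTorus_surjective.comp (frame_surjective he)).prodMap (frame_surjective he)).comp
    (Homeomorph.prodProdProdComm ℝ ℝ ℝ ℝ).surjective

theorem isOpenMap_phasePoint (he : e ≠ 0) : IsOpenMap (phasePoint e) := by
  have hframe : IsOpenMap (frame e) := (frame e).isOpenMap (frame_surjective he)
  exact ((isOpenMap_toTorus.comp hframe).prodMap hframe).comp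
    (Homeomorph.prodProdProdComm ℝ ℝ ℝ ℝ).isOpenMap

theorem isQuotientMap_phasePoint (he : e ≠ 0) : IsQuotientMap (phasePoint e) :=
  (isOpenMap_phasePoint he).isQuotientMap continuous_phasePoint (phasePoint_surjective he)

theorem hamPar_phasePoint (he : e ≠ 0) (p : (ℝ × ℝ) × (ℝ × ℝ)) :
    hamPar e (phasePoint e p) = p.2.2 := by
  simpa only [hamPar, phasePoint, unitPar, inner_smul_right] using
    inner_frame_unitPar he (p.1.2, p.2.2)

theorem hamPerp_phasePoint (he : e ≠ 0) (p : (ℝ × ℝ) × (ℝ × ℝ)) :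
    hamPerp e (phasePoint e p) = p.1.2 := by
  simpa only [hamPerp, phasePoint, unitPerp, inner_smul_right] using
    inner_frame_unitPerp he (p.1.2, p.2.2)

theorem inner_vec_unitPar (k : Fin 2 → ℤ) :
    inner ℝ (vec k) (unitPar e) = ((k 0 * e 0 + k 1 * e 1 : ℤ) : ℝ) / len e := by
  rw [inner_unitPar]
  simp [vec]

/-- The first coordinate of the state is determined by the position up to multiples of
`1 / L_Λ`. -/
theorem snd_eq_of_phasePoint_eq (he : e ≠ 0) {p p' : (ℝ × ℝ) × (ℝ × ℝ)}
    (h : phasePoint e p = phasePoint e p') (hdist : |p.2.1 - p'.2.1| < 1 / len e) :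
    p.2 = p'.2 := by
  have hlen := len_pos he
  obtain ⟨hpos, hmom⟩ := Prod.mk.inj h
  obtain ⟨k, hk⟩ := toTorus_eq_iff.1 hpos
  replace hk := congrArg (inner ℝ · (unitPar e)) hk
  simp only [inner_add_left, inner_frame_unitPar he, inner_vec_unitPar] at hk
  rw [hk, add_sub_cancel_left, abs_div, abs_of_pos hlen, div_lt_div_iff_of_pos_right hlen,
    ← Int.cast_abs, ← Int.cast_one, Int.cast_lt, Int.abs_lt_one_iff] at hdist
  refine Prod.ext (by simpa [hdist] using hk) ?_
  simpa only [inner_frame_unitPar he] using congrArg (inner ℝ · (unitPar e)) hmom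

end Frame

theorem hasGradientAt_comp_inner {F : Type*} [NormedAddCommGroup F] [InnerProductSpace ℝ F]
    [CompleteSpace F] {W : ℝ → ℝ} {w : ℝ} {u y : F} (hW : HasDerivAt W w (inner ℝ y u)) :
    HasGradientAt (fun x => W (inner ℝ x u)) (w • u) y := by
  have hinner : HasFDerivAt (fun x => inner ℝ x u) (innerSL ℝ u) y := by
    simpa only [real_inner_comm u] using! (innerSL ℝ u).hasFDerivAt (x := y)
  rw [hasGradientAt_iff_hasFDerivAt]
  convert! hW.comp_hasFDerivAt y hinner using 1
  ext x
  simp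

section Profile

variable {e : Fin 2 → ℤ} {V : Torus → ℝ}

/-- The potential `I_Λ(V)` as a function of the coordinate `⟨x, 𝔢_Λ⟩ / L_Λ`, the only one on which
it depends. -/
def profile (e : Fin 2 → ℤ) (V : Torus → ℝ) (q : ℝ) : ℝ := average e V (toTorus (q • unitPar e))

theorem average_toTorus (y : Plane) : average e V (toTorus y) =
    1 / len e * ∫ s in (0 : ℝ)..len e, V (toTorus (y + s • unitPerp e)) := by
  simp only [average, toTorus_add, unitPerp, smul_smul, mul_one_div]

theorem average_toTorus_add_smul_unitPerp (he : e ≠ 0) (y : Plane) (r : ℝ) :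
    average e V (toTorus (y + r • unitPerp e)) = average e V (toTorus y) := by
  have hper : Function.Periodic (fun s : ℝ => V (toTorus (y + s • unitPerp e))) (len e) := by
    intro s
    simp only [add_smul, ← add_assoc, len_smul_unitPerp he, toTorus_add_vec]
  have hshift := intervalIntegral.integral_comp_add_left
    (fun s : ℝ => V (toTorus (y + s • unitPerp e))) r (a := 0) (b := len e)
  simp only [add_smul, ← add_assoc, add_zero] at hshift
  rw [average_toTorus, average_toTorus, hshift]
  simpa using congrArg (1 / len e * ·) (hper.intervalIntegral_add_eq r 0)

theorem average_toTorus_frame (he : e ≠ 0) (x : ℝ × ℝ) :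
    average e V (toTorus (frame e x)) = profile e V x.2 := by
  rw [frame_apply, add_comm, average_toTorus_add_smul_unitPerp he, profile]

theorem average_toTorus_eq_profile (he : e ≠ 0) (y : Plane) :
    average e V (toTorus y) = profile e V (inner ℝ y (unitPar e)) := by
  conv_lhs => rw [← frame_inner he y, average_toTorus_frame he]

theorem periodic_profile (he : e ≠ 0) : Function.Periodic (profile e V) (len e) := fun q => by
  rw [profile, add_smul, len_smul_unitPar he, toTorus_add_vec, profile]

theorem contDiff_profile {n : ℕ} (hV : ContDiff ℝ n fun y => V (toTorus y)) :
    ContDiff ℝ n (profile e V) := by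
  have hprofile : profile e V = fun q =>
      1 / len e * ∫ s in (0 : ℝ)..len e, V (toTorus (q • unitPar e + s • unitPerp e)) :=
    funext fun q => average_toTorus _
  rw [hprofile]
  refine contDiff_const.mul (contDiff_intervalIntegral ?_ 0 (len e))
  exact hV.comp (f := fun p : ℝ × ℝ => p.1 • unitPar e + p.2 • unitPerp e) (by fun_prop)

/-- The derivative of the averaged potential `I_Λ(V)` in the direction `𝔢_Λ / L_Λ`. -/
def force (e : Fin 2 → ℤ) (V : Torus → ℝ) : ℝ → ℝ := deriv (profile e V)

variable (hV : ContDiff ℝ 2 fun y => V (toTorus y))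
include hV

theorem hasDerivAt_profile (q : ℝ) : HasDerivAt (profile e V) (force e V q) q :=
  ((contDiff_profile hV).differentiable two_ne_zero q).hasDerivAt

theorem contDiff_force : ContDiff ℝ 1 (force e V) :=
  (contDiff_profile hV).iterate_deriv' 1 1

theorem exists_lipschitzWith_force (he : e ≠ 0) : ∃ K, LipschitzWith K (force e V) := by
  refine exists_lipschitzWith_of_periodic (contDiff_force hV) (len_pos he) fun q => ?_
  rw [force, ← deriv_comp_add_const, funext (periodic_profile he)]

theorem torusGradient_average (he : e ≠ 0) (y : Plane) :
    torusGradient (average e V) (toTorus y) =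
      force e V (inner ℝ y (unitPar e)) • unitPar e := by
  apply HasGradientAt.gradient
  simp only [← toTorus_add, average_toTorus_eq_profile he, inner_add_left]
  refine hasGradientAt_comp_inner (W := fun t => profile e V (inner ℝ y (unitPar e) + t))
    (HasDerivAt.comp_const_add _ _ ?_)
  simpa using hasDerivAt_profile hV (inner ℝ y (unitPar e))

end Profile

section Flow

/-- The projection `ℝ² × ℝ² → T*𝕋²` of the universal cover of phase space. -/
def toPhase (p : Plane × Plane) : Phase := (toTorus p.1, p.2)

/-- The lift of the Hamiltonian vector field of `h` to the universal cover of phase space. -/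
def liftedField (h : Phase → ℝ) (p : Plane × Plane) : Plane × Plane :=
  (gradMom h (toPhase p), -gradPos h (toPhase p))

theorem hamiltonianFlow_toPhase {h : Phase → ℝ} {K : ℝ≥0} {γ : ℝ → Plane × Plane}
    (hK : LipschitzWith K (liftedField h)) (hγ : IsIntegralCurve γ fun _ => liftedField h)
    (t : ℝ) : hamiltonianFlow h t (toPhase (γ 0)) = toPhase (γ t) := by
  have hex : ∃ c, IsHamiltonianCurve h c ∧ c 0 = toPhase (γ 0) :=
    ⟨toPhase ∘ γ, ⟨fun t => (γ t).1, fun t => (γ t).2,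
      fun t => ⟨rfl, (hγ t).fst, (hγ t).snd⟩⟩, rfl⟩
  rw [hamiltonianFlow, dif_pos hex]
  obtain ⟨⟨X, Ξ, hX⟩, h₀⟩ := hex.choose_spec
  generalize hex.choose = c at hX h₀
  have hc (t : ℝ) : c t = toPhase (X t, Ξ t) := (hX t).1
  obtain ⟨hpos, hmom⟩ := Prod.mk.inj ((hc 0).symm.trans h₀)
  obtain ⟨k, hk⟩ := toTorus_eq_iff.1 hpos
  have hlift : IsIntegralCurve (fun t => (X t, Ξ t)) fun _ => liftedField h := fun t => by
    simpa only [liftedField, ← hc] using (hX t).2.1.prodMk (hX t).2.2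
  have htrans : IsIntegralCurve (fun t => γ t + (vec k, 0)) fun _ => liftedField h := fun t => by
    simpa only [liftedField, toPhase, Prod.fst_add, Prod.snd_add, toTorus_add_vec, add_zero]
      using (hγ t).add_const (vec k, 0)
  have heq := isIntegralCurve_unique hK hlift htrans (t₀ := 0) (Prod.ext hk (by simpa using hmom))
  rw [hc, congrFun heq t]
  simp only [toPhase, Prod.fst_add, Prod.snd_add, toTorus_add_vec, add_zero]

variable {e : Fin 2 → ℤ} {V : Torus → ℝ}

theorem liftedField_hamPerp : liftedField (hamPerp e) = fun _ => (unitPerp e, 0) := by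
  funext p
  refine Prod.ext (HasGradientAt.gradient ?_) ?_
  · simpa [hamPerp, unitPerp, toPhase, inner_smul_right] using
      hasGradientAt_comp_inner (y := p.2) (u := unitPerp e) (hasDerivAt_id _)
  · simp [liftedField, gradPos, torusGradient, hamPerp, gradient_fun_const]

theorem liftedField_hamP (he : e ≠ 0) (hV : ContDiff ℝ 2 fun y => V (toTorus y))
    (p : Plane × Plane) : liftedField (hamP e V) p =
      (inner ℝ p.2 (unitPar e) • unitPar e,
        -(force e V (inner ℝ p.1 (unitPar e)) • unitPar e)) := by
  refine Prod.ext (HasGradientAt.gradient ?_) (congrArg Neg.neg ?_)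
  · have hsq : HasDerivAt (fun t : ℝ => t ^ 2 / 2 + average e V (toTorus p.1))
        (inner ℝ p.2 (unitPar e)) (inner ℝ p.2 (unitPar e)) := by
      simpa using ((hasDerivAt_pow 2 _).div_const 2).add_const (average e V (toTorus p.1))
    simpa [hamP, hamPar, toPhase, unitPar, inner_smul_right] using hasGradientAt_comp_inner hsq
  · rw [← torusGradient_average hV he]
    simp [gradPos, torusGradient, gradient, hamP, hamPar, toPhase, fderiv_const_add]

theorem exists_lipschitzWith_liftedField_hamP (he : e ≠ 0)
    (hV : ContDiff ℝ 2 fun y => V (toTorus y)) :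
    ∃ K, LipschitzWith K (liftedField (hamP e V)) := by
  obtain ⟨K, hK⟩ := exists_lipschitzWith_force hV he
  have hinner : LipschitzWith ‖innerSL ℝ (unitPar e)‖₊ fun x : Plane => inner ℝ x (unitPar e) := by
    simpa only [real_inner_comm (unitPar e)] using! (innerSL ℝ (unitPar e)).lipschitz
  have hsmul := (ContinuousLinearMap.toSpanSingleton ℝ (unitPar e)).lipschitz
  exact ⟨_, funext (liftedField_hamP he hV) ▸
    (hsmul.comp (hinner.comp .prod_snd)).prodMk (hsmul.comp (hK.comp (hinner.comp .prod_fst))).neg⟩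

end Flow

section Orbits

variable {e : Fin 2 → ℤ} {V : Torus → ℝ}

theorem hamiltonianFlow_hamPerp (s : ℝ) (p : (ℝ × ℝ) × (ℝ × ℝ)) :
    hamiltonianFlow (hamPerp e) s (phasePoint e p) =
      phasePoint e ((p.1.1 + s, p.1.2), p.2) := by
  have hK : LipschitzWith 0 (liftedField (hamPerp e)) :=
    liftedField_hamPerp (e := e) ▸ LipschitzWith.const _
  have hflow := hamiltonianFlow_toPhase hK
    (γ := fun s => (frame e (p.1.1 + s, p.2.1), frame e (p.1.2, p.2.2))) (fun t => ?_) s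
  · simpa [phasePoint, toPhase] using hflow
  · have hpos : HasDerivAt (fun s => frame e (p.1.1 + s, p.2.1)) (frame e (1, 0)) t :=
      (frame e).hasFDerivAt.comp_hasDerivAt t
        (((hasDerivAt_id t).const_add p.1.1).prodMk (hasDerivAt_const t p.2.1))
    rw [liftedField_hamPerp]
    simpa [frame_apply] using hpos.prodMk (hasDerivAt_const t (frame e (p.1.2, p.2.2)))

theorem moment_phasePoint (he : e ≠ 0) (p : (ℝ × ℝ) × (ℝ × ℝ)) :
    moment e V (phasePoint e p) = (p.1.2, newtonEnergy (profile e V) p.2) := by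
  rw [moment, hamP, hamPerp_phasePoint he, hamPar_phasePoint he, phasePoint,
    average_toTorus_frame he, newtonEnergy]

variable (he : e ≠ 0) (hV : ContDiff ℝ 2 fun y => V (toTorus y))
include he hV

theorem hamiltonianFlow_hamP {γ : ℝ → ℝ × ℝ}
    (hγ : IsIntegralCurve γ fun _ => newtonField (force e V)) (w : ℝ × ℝ) (t : ℝ) :
    hamiltonianFlow (hamP e V) t (phasePoint e (w, γ 0)) = phasePoint e (w, γ t) := by
  obtain ⟨K, hK⟩ := exists_lipschitzWith_liftedField_hamP he hV
  refine hamiltonianFlow_toPhase hK (γ := fun t => (frame e (w.1, (γ t).1),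
    frame e (w.2, (γ t).2))) (fun t => ?_) t
  have hframe (r : ℝ) {g : ℝ → ℝ} {g' : ℝ} (hg : HasDerivAt g g' t) :
      HasDerivAt (fun t => frame e (r, g t)) (g' • unitPar e) t := by
    simpa only [frame_apply] using (hg.smul_const (unitPar e)).const_add (r • unitPerp e)
  beta_reduce
  rw [liftedField_hamP he hV, inner_frame_unitPar he, inner_frame_unitPar he, ← neg_smul]
  exact (hframe w.1 (hγ t).fst).prodMk (hframe w.2 (hγ t).snd)

theorem orbitMap_phasePoint {γ : ℝ → ℝ × ℝ}
    (hγ : IsIntegralCurve γ fun _ => newtonField (force e V)) (w a : ℝ × ℝ) :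
    orbitMap e V (phasePoint e (w, γ 0)) a = phasePoint e ((w.1 + a.1, w.2), γ a.2) := by
  rw [orbitMap, hamiltonianFlow_hamP he hV hγ, hamiltonianFlow_hamPerp]

theorem exists_isIntegralCurve_phasePoint_eq (z : Phase) : ∃ (w : ℝ × ℝ) (γ : ℝ → ℝ × ℝ),
    (IsIntegralCurve γ fun _ => newtonField (force e V)) ∧ phasePoint e (w, γ 0) = z := by
  obtain ⟨⟨w, x⟩, rfl⟩ := phasePoint_surjective he z
  obtain ⟨K, hK⟩ := exists_lipschitzWith_force hV he
  obtain ⟨γ, rfl, hγ⟩ := exists_isIntegralCurve_of_lipschitzWith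
    (contDiff_newtonField (contDiff_force hV)) (lipschitzWith_newtonField hK) x
  exact ⟨w, γ, hγ, rfl⟩

theorem continuous_orbitMap (z : Phase) : Continuous (orbitMap e V z) := by
  obtain ⟨w, γ, hγ, rfl⟩ := exists_isIntegralCurve_phasePoint_eq he hV z
  have hcont : Continuous γ := hγ.continuous
  rw [funext (orbitMap_phasePoint he hV hγ w)]
  exact continuous_phasePoint.comp (by fun_prop)

theorem orbitMap_zero (z : Phase) : orbitMap e V z 0 = z := by
  obtain ⟨w, γ, hγ, rfl⟩ := exists_isIntegralCurve_phasePoint_eq he hV z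
  simp [orbitMap_phasePoint he hV hγ]

theorem orbitMap_fst (z : Phase) (s : ℝ) :
    orbitMap e V z (s, 0) = hamiltonianFlow (hamPerp e) s z := by
  obtain ⟨w, γ, hγ, rfl⟩ := exists_isIntegralCurve_phasePoint_eq he hV z
  rw [orbitMap, hamiltonianFlow_hamP he hV hγ]

theorem orbitMap_add (z : Phase) (a b : ℝ × ℝ) :
    orbitMap e V z (a + b) = orbitMap e V (orbitMap e V z b) a := by
  obtain ⟨w, γ, hγ, rfl⟩ := exists_isIntegralCurve_phasePoint_eq he hV z
  have hshift := orbitMap_phasePoint he hV (hγ.comp_add b.2) (w.1 + b.1, w.2) a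
  simp only [Function.comp_apply, zero_add] at hshift
  rw [orbitMap_phasePoint he hV hγ, orbitMap_phasePoint he hV hγ, hshift]
  simp only [Prod.fst_add, Prod.snd_add, add_assoc, add_comm b.1]

theorem moment_orbitMap (z : Phase) (a : ℝ × ℝ) :
    moment e V (orbitMap e V z a) = moment e V z := by
  obtain ⟨w, γ, hγ, rfl⟩ := exists_isIntegralCurve_phasePoint_eq he hV z
  rw [orbitMap_phasePoint he hV hγ, moment_phasePoint he, moment_phasePoint he,
    newtonEnergy_eq_of_isIntegralCurve (hasDerivAt_profile hV) hγ a.2 0]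

theorem phasePoint_mem_regular_iff (p : (ℝ × ℝ) × (ℝ × ℝ)) :
    phasePoint e p ∈ regular e V ↔ newtonField (force e V) p.2 ≠ 0 := by
  rw [newtonField_ne_zero_iff, regular, crit, mem_compl_iff, mem_ofPred, hamPar_phasePoint he,
    phasePoint, torusGradient_average hV he, inner_frame_unitPar he, not_and_or,
    smul_eq_zero_iff_left (unitPar_ne_zero he)]

theorem isOpen_regular : IsOpen (regular e V) := by
  have hcont : Continuous (newtonField (force e V)) :=
    (contDiff_newtonField (contDiff_force hV)).continuous
  rw [← (isQuotientMap_phasePoint he).isOpen_preimage]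
  simp only [preimage, phasePoint_mem_regular_iff he hV]
  exact isOpen_ne_fun (by fun_prop) continuous_const

theorem continuous_moment : Continuous (moment e V) := by
  have hcont : Continuous (profile e V) := (contDiff_profile hV).continuous
  have hcomp : moment e V ∘ phasePoint e = fun p => (p.1.2, newtonEnergy (profile e V) p.2) :=
    funext (moment_phasePoint he)
  rw [(isQuotientMap_phasePoint he).continuous_iff, hcomp]
  unfold newtonEnergy
  fun_prop

theorem orbitMap_mem_regular {z : Phase} (hz : z ∈ regular e V) (a : ℝ × ℝ) :
    orbitMap e V z a ∈ regular e V := by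
  obtain ⟨w, γ, hγ, rfl⟩ := exists_isIntegralCurve_phasePoint_eq he hV z
  obtain ⟨K, hK⟩ := exists_lipschitzWith_force hV he
  rw [phasePoint_mem_regular_iff he hV] at hz
  rw [orbitMap_phasePoint he hV hγ, phasePoint_mem_regular_iff he hV]
  exact fun h => hz (eq_zero_of_isIntegralCurve (lipschitzWith_newtonField hK) hγ h 0)

theorem orbitMap_mem_levelSet {h : ℝ × ℝ} {z : Phase} (hz : z ∈ levelSet e V h) (a : ℝ × ℝ) :
    orbitMap e V z a ∈ levelSet e V h :=
  ⟨orbitMap_mem_regular he hV hz.1 a, (moment_orbitMap he hV z a).trans hz.2⟩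

theorem image_orbitMap_mem_nhdsWithin {h : ℝ × ℝ} {z : Phase} (hz : z ∈ levelSet e V h)
    {T : Set (ℝ × ℝ)} (hT : T ∈ 𝓝 0) : orbitMap e V z '' T ∈ 𝓝[levelSet e V h] z := by
  obtain ⟨hreg, rfl⟩ := hz
  obtain ⟨w, γ, hγ, rfl⟩ := exists_isIntegralCurve_phasePoint_eq he hV z
  obtain ⟨T₁, hT₁, T₂, hT₂, hT₁₂⟩ := mem_nhds_prod_iff.1 hT
  have hcurve := eventually_mem_image_of_newtonEnergy_eq (hasDerivAt_profile hV)
    (contDiff_force hV).continuous hγ ((phasePoint_mem_regular_iff he hV _).1 hreg) hT₂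
  have hshift : ∀ᶠ s in 𝓝 w.1, s - w.1 ∈ T₁ :=
    (continuous_sub_right w.1).tendsto' _ 0 (sub_self _) hT₁
  have hnhds := (isOpenMap_phasePoint he).image_mem_nhds
    (((continuous_fst.comp continuous_fst).tendsto (w, γ 0) |>.eventually hshift).and
      (continuous_snd.tendsto (w, γ 0) |>.eventually hcurve))
  filter_upwards [mem_nhdsWithin_of_mem_nhds hnhds, self_mem_nhdsWithin]
  rintro _ ⟨⟨⟨s, σ⟩, x⟩, ⟨hs, hx⟩, rfl⟩ ⟨-, hmoment⟩
  obtain ⟨rfl, henergy⟩ := Prod.mk.inj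
    ((moment_phasePoint he _).symm.trans (hmoment.trans (moment_phasePoint he _)))
  obtain ⟨t, ht, rfl⟩ := hx henergy
  refine ⟨(s - w.1, t), hT₁₂ (mk_mem_prod hs ht), ?_⟩
  rw [orbitMap_phasePoint he hV hγ, add_sub_cancel]

theorem eventually_orbitMap_ne {z : Phase} (hz : z ∈ regular e V) :
    ∀ᶠ t in 𝓝[≠] (0 : ℝ), ∀ s s', orbitMap e V z (s, t) ≠ orbitMap e V z (s', 0) := by
  obtain ⟨w, γ, hγ, rfl⟩ := exists_isIntegralCurve_phasePoint_eq he hV z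
  have hne := (hγ 0).eventually_ne (c := γ 0) ((phasePoint_mem_regular_iff he hV _).1 hz)
  have hclose : ∀ᶠ t in 𝓝 0, |(γ t).1 - (γ 0).1| < 1 / len e := by
    have hcont : Continuous γ := hγ.continuous
    exact (by fun_prop : Continuous fun t => |(γ t).1 - (γ 0).1|).continuousAt.eventually_lt_const
      (by simpa using len_pos he)
  filter_upwards [hne, nhdsWithin_le_nhds hclose] with t ht htclose s s' heq
  rw [orbitMap_phasePoint he hV hγ, orbitMap_phasePoint he hV hγ] at heq
  exact ht (snd_eq_of_phasePoint_eq he heq htclose)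

end Orbits

theorem exists_ae_eq_forall {α β : Type*} [MeasurableSpace α] {m : Measure α}
    {P : α → β → Prop} {f : α → β} (hex : ∀ a, ∃ b, P a b) (hf : ∀ᵐ a ∂m, P a (f a)) :
    ∃ g, g =ᵐ[m] f ∧ ∀ a, P a (g a) := by
  classical
  choose g hg using hex
  refine ⟨fun a => if P a (f a) then f a else g a, hf.mono fun a ha => if_pos ha, fun a => ?_⟩
  beta_reduce
  split_ifs with ha
  exacts [ha, hg a]

section Action

open AddAction ProbabilityTheory

variable {e : Fin 2 → ℤ} {V : Torus → ℝ}

theorem mem_image_compactPart_of_isConvexCombOfTori {h : ℝ × ℝ} {m : Measure Phase}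
    (hm : IsConvexCombOfTori e V h m) : h ∈ moment e V '' compactPart e V := by
  obtain ⟨z, -, -, hz, -⟩ := hm
  exact ⟨z 0, (hz 0).2, (hz 0).1.2⟩

/-- The action of `ℝ²` on phase space by the commuting flows of `H_Λ^⊥` and `p_Λ`. -/
abbrev hamiltonianAction (he : e ≠ 0) (hV : ContDiff ℝ 2 fun y => V (toTorus y)) :
    AddAction (ℝ × ℝ) Phase where
  vadd a z := orbitMap e V z a
  zero_vadd := orbitMap_zero he hV
  add_vadd a b z := orbitMap_add he hV z a b

variable (he : e ≠ 0) (hV : ContDiff ℝ 2 fun y => V (toTorus y))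
include he hV

theorem periodGroup_eq_stabilizer (z : Phase) :
    letI := hamiltonianAction he hV
    periodGroup e V z = stabilizer (ℝ × ℝ) z := by
  let _ := hamiltonianAction he hV
  ext g
  refine ⟨fun hg => ?_, fun (hg : g +ᵥ z = z) w => ?_⟩
  · have hzero := hg 0
    rwa [add_zero, orbitMap_zero he hV] at hzero
  · change (g + w) +ᵥ z = w +ᵥ z
    rw [add_comm, add_vadd, hg]

theorem isTorusHaar_of_isOrbitHaar {z : Phase} {m : Measure Phase}
    (hm : letI := hamiltonianAction he hV; IsOrbitHaar (ℝ × ℝ) z m) : IsTorusHaar e V z m := by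
  let _ := hamiltonianAction he hV
  -- The subgroup varies because quotients by equal subgroups are different types.
  have haar_of_eq (S : AddSubgroup (ℝ × ℝ)) (hS : S = stabilizer (ℝ × ℝ) z)
      (f : (ℝ × ℝ) ⧸ S → Phase) (hf : ∀ a : ℝ × ℝ, f a = a +ᵥ z) :
      ∃ ν : Measure ((ℝ × ℝ) ⧸ S), ν.IsAddHaarMeasure ∧ IsProbabilityMeasure ν ∧ m = ν.map f := by
    subst hS
    obtain ⟨ν, hν, hprob, rfl⟩ := hm
    exact ⟨ν, hν, hprob, congrArg ν.map
      (funext (QuotientAddGroup.mk_surjective.forall.2 hf)).symm⟩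
  exact haar_of_eq _ (periodGroup_eq_stabilizer he hV z) _ fun _ => rfl

theorem isLocallyTransitiveOn_levelSet (h : ℝ × ℝ) :
    letI := hamiltonianAction he hV
    IsLocallyTransitiveOn (ℝ × ℝ) (levelSet e V h) :=
  fun _ hz _ hT => image_orbitMap_mem_nhdsWithin he hV hz hT

theorem component_eq_orbit {z : Phase} (hz : z ∈ regular e V) :
    letI := hamiltonianAction he hV
    component e V z = orbit (ℝ × ℝ) z := by
  let _ := hamiltonianAction he hV
  exact connectedComponentIn_eq_orbit (continuous_orbitMap he hV)
    (fun g x hx => orbitMap_mem_levelSet he hV hx g) (isLocallyTransitiveOn_levelSet he hV _)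
    ⟨hz, rfl⟩

theorem mem_compactPart_of_isOrbitHaar {z : Phase} {m : Measure Phase} (hz : z ∈ regular e V)
    (hm : letI := hamiltonianAction he hV; IsOrbitHaar (ℝ × ℝ) z m) : z ∈ compactPart e V := by
  let _ := hamiltonianAction he hV
  have hcont := continuous_orbitMap he hV z
  have := isClosed_stabilizer hcont
  have := hm.compactSpace
  exact ⟨hz, component_eq_orbit he hV hz ▸ isCompact_orbit hcont⟩

theorem exists_isTorusHaar {z : Phase} (hz : z ∈ compactPart e V) :
    ∃ m, IsTorusHaar e V z m := by
  let _ := hamiltonianAction he hV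
  have hcont := continuous_orbitMap he hV z
  have := compactSpace_quotient_stabilizer hcont
    (range_subset_iff.2 (orbitMap_mem_levelSet he hV ⟨hz.1, rfl⟩))
    (isLocallyTransitiveOn_levelSet he hV _) (component_eq_orbit he hV hz.1 ▸ hz.2)
  have := isClosed_stabilizer hcont
  obtain ⟨m, hm⟩ := exists_isOrbitHaar (G := ℝ × ℝ) (z := z)
  exact ⟨m, isTorusHaar_of_isOrbitHaar he hV hm⟩

theorem exists_isConvexCombOfTori {h : ℝ × ℝ} (hh : h ∈ moment e V '' compactPart e V) :
    ∃ m, IsConvexCombOfTori e V h m := by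
  obtain ⟨z, hz, rfl⟩ := hh
  obtain ⟨m, hm⟩ := exists_isTorusHaar he hV hz
  exact ⟨_, fun _ => z, Pi.single 0 1, fun _ => m, fun _ => ⟨⟨hz.1, rfl⟩, hz⟩, fun _ => hm,
    tsum_pi_single 0 1, rfl⟩

theorem isConvexCombOfTori_of_vaddInvariantMeasure {h : ℝ × ℝ} {m : Measure Phase}
    [IsProbabilityMeasure m]
    (hinv : letI := hamiltonianAction he hV; VAddInvariantMeasure (ℝ × ℝ) Phase m)
    (hm : ∀ᵐ z ∂m, z ∈ levelSet e V h) : IsConvexCombOfTori e V h m := by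
  let _ := hamiltonianAction he hV
  obtain ⟨z, c, τ, hz, hτ, hc, hsum⟩ := exists_isOrbitHaar_sum_eq (continuous_orbitMap he hV)
    (isLocallyTransitiveOn_levelSet he hV h) hm
  exact ⟨z, c, τ, fun n => ⟨hz n, mem_compactPart_of_isOrbitHaar he hV (hz n).1 (hτ n)⟩,
    fun n => isTorusHaar_of_isOrbitHaar he hV (hτ n), hc, hsum⟩

section InvariantMeasure

variable {μ : Measure Phase}

theorem ae_ae_mem_levelSet_condDistrib [IsFiniteMeasure μ] (hμR : ∀ᵐ z ∂μ, z ∈ regular e V) :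
    ∀ᵐ h ∂(μ.map (moment e V)), ∀ᵐ z ∂(condDistrib id (moment e V) μ h), z ∈ levelSet e V h :=
  ae_ae_condDistrib_id (continuous_moment he hV).measurable (isOpen_regular he hV).measurableSet hμR

theorem integral_regular_eq_integral_levelSet [IsFiniteMeasure μ]
    (hμR : ∀ᵐ z ∂μ, z ∈ regular e V) {lam : ℝ × ℝ → Measure Phase}
    (hlam : lam =ᵐ[μ.map (moment e V)] condDistrib id (moment e V) μ)
    {E : Type*} [NormedAddCommGroup E] [NormedSpace ℝ E] {a : Phase → E} (ha : Integrable a μ) :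
    IntegrableOn (fun h => ∫ z in levelSet e V h, a z ∂(lam h))
        (moment e V '' regular e V) (μ.map (moment e V)) ∧
      ∫ z in regular e V, a z ∂μ =
        ∫ h in moment e V '' regular e V,
          (∫ z in levelSet e V h, a z ∂(lam h)) ∂(μ.map (moment e V)) := by
  have hlevel := ae_ae_mem_levelSet_condDistrib he hV hμR
  have himage : ∀ᵐ h ∂(μ.map (moment e V)), h ∈ moment e V '' regular e V :=
    hlevel.mono fun h hh => hh.exists
  have hinner : (fun h => ∫ z in levelSet e V h, a z ∂(lam h)) =ᵐ[μ.map (moment e V)]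
      fun h => ∫ z, a z ∂(condDistrib id (moment e V) μ h) := by
    filter_upwards [hlevel, hlam] with h hh heq
    rw [heq, Measure.restrict_eq_self_of_ae_mem hh]
  rw [IntegrableOn, Measure.restrict_eq_self_of_ae_mem himage,
    Measure.restrict_eq_self_of_ae_mem hμR, integral_congr_ae hinner, integrable_congr hinner]
  exact integral_condDistrib_id (continuous_moment he hV).measurable ha

variable (hinvPerp : ∀ s, MeasurePreserving (hamiltonianFlow (hamPerp e) s) μ μ)
  (hinvP : ∀ t, MeasurePreserving (hamiltonianFlow (hamP e V) t) μ μ)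
include hinvPerp hinvP

theorem measurableConstVAdd_hamiltonianAction :
    letI := hamiltonianAction he hV
    MeasurableConstVAdd (ℝ × ℝ) Phase :=
  let _ := hamiltonianAction he hV
  ⟨fun a => (hinvPerp a.1).measurable.comp (hinvP a.2).measurable⟩

theorem vaddInvariantMeasure_hamiltonianAction :
    letI := hamiltonianAction he hV
    VAddInvariantMeasure (ℝ × ℝ) Phase μ :=
  let _ := hamiltonianAction he hV
  ⟨fun a _ hC => ((hinvPerp a.1).comp (hinvP a.2)).measure_preimage hC.nullMeasurableSet⟩

variable [IsFiniteMeasure μ]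

theorem measure_image_hamiltonianFlow_hamPerp_eq_zero {z : Phase} (hz : z ∈ regular e V)
    {S : Set ℝ} (hS : IsCompact S) :
    μ ((fun s => hamiltonianFlow (hamPerp e) s z) '' S) = 0 := by
  let _ := hamiltonianAction he hV
  have := measurableConstVAdd_hamiltonianAction he hV hinvPerp hinvP
  have := vaddInvariantMeasure_hamiltonianAction he hV hinvPerp hinvP
  simp only [← orbitMap_fst he hV]
  refine measure_eq_zero_of_eventually_disjoint_vadd (AddMonoidHom.inr ℝ ℝ)
    (hS.image ((continuous_orbitMap he hV z).comp (by fun_prop))).isClosed.measurableSet ?_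
  filter_upwards [eventually_orbitMap_ne he hV hz] with t ht
  rw [disjoint_left]
  rintro _ ⟨_, ⟨s, -, rfl⟩, rfl⟩ ⟨s', -, hs'⟩
  refine ht s s' (Eq.trans ?_ hs'.symm)
  change orbitMap e V z (s, t) = orbitMap e V (orbitMap e V z (s, 0)) (0, t)
  rw [← orbitMap_add he hV, Prod.mk_add_mk, zero_add, add_zero]

theorem ae_isConvexCombOfTori_condDistrib (hμR : ∀ᵐ z ∂μ, z ∈ regular e V) :
    ∀ᵐ h ∂(μ.map (moment e V)), IsConvexCombOfTori e V h (condDistrib id (moment e V) μ h) := by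
  let _ := hamiltonianAction he hV
  have := measurableConstVAdd_hamiltonianAction he hV hinvPerp hinvP
  have := vaddInvariantMeasure_hamiltonianAction he hV hinvPerp hinvP
  filter_upwards [ae_vaddInvariantMeasure_condDistrib (continuous_orbitMap he hV)
      (continuous_moment he hV).measurable fun a z => moment_orbitMap he hV z a,
    ae_ae_mem_levelSet_condDistrib he hV hμR] with h hinv hlevel
  exact isConvexCombOfTori_of_vaddInvariantMeasure he hV hinv hlevel

end InvariantMeasure

theorem exists_isConvexCombOfTori_or_eq_zero (h : ℝ × ℝ) : ∃ m : Measure Phase,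
    IsConvexCombOfTori e V h m ∨ h ∉ moment e V '' compactPart e V ∧ m = 0 := by
  by_cases hh : h ∈ moment e V '' compactPart e V
  · exact (exists_isConvexCombOfTori he hV hh).imp fun _ => Or.inl
  · exact ⟨0, .inr ⟨hh, rfl⟩⟩

end Action

theorem ne_zero_of_isPrimitiveRankOne {Λ : AddSubgroup (Fin 2 → ℤ)} (hΛ : IsPrimitiveRankOne Λ)
    {e : Fin 2 → ℤ} (he : AddSubgroup.zmultiples e = Λ) : e ≠ 0 := by
  rintro rfl
  have hrank := hΛ.1
  rw [← he, AddSubgroup.zmultiples_zero_eq_bot, AddSubgroup.coe_bot, image_singleton,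
    vec_eq_zero_iff.2 rfl, Submodule.span_zero_singleton, finrank_bot] at hrank
  exact zero_ne_one hrank

end BiInvariant

end

open ProbabilityTheory in
theorem propositionA1_general {e : Fin 2 → ℤ} (he : e ≠ 0) {V : Torus → ℝ}
    (hV : ContDiff ℝ 2 fun y => V (toTorus y)) {μ : Measure Phase} [IsFiniteMeasure μ]
    (hμR : μ (regular e V)ᶜ = 0)
    (hinvPerp : ∀ s : ℝ, MeasurePreserving (hamiltonianFlow (hamPerp e) s) μ μ)
    (hinvP : ∀ t : ℝ, MeasurePreserving (hamiltonianFlow (hamP e V) t) μ μ) :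
    (∃ lam : ℝ × ℝ → Measure Phase,
      AEMeasurable lam (μ.map (moment e V)) ∧
      (∀ h ∈ moment e V '' compactPart e V, IsConvexCombOfTori e V h (lam h)) ∧
      (∀ h ∈ moment e V '' regular e V \ moment e V '' compactPart e V, lam h = 0) ∧
      (∀ᵐ h ∂(μ.map (moment e V)), h ∈ moment e V '' compactPart e V) ∧
      ∀ a : Phase → ℝ, Integrable a μ →
        IntegrableOn (fun h => ∫ z in levelSet e V h, a z ∂(lam h))
          (moment e V '' regular e V) (μ.map (moment e V)) ∧
        ∫ z in regular e V, a z ∂μ =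
          ∫ h in moment e V '' regular e V,
            (∫ z in levelSet e V h, a z ∂(lam h)) ∂(μ.map (moment e V))) ∧
    ∀ z ∈ regular e V,
      μ {w | ∃ s : ℝ, 0 ≤ s ∧ s ≤ len e ∧ w = hamiltonianFlow (hamPerp e) s z} = 0 := by
  have htori := ae_isConvexCombOfTori_condDistrib he hV hinvPerp hinvP hμR
  obtain ⟨lam, hlam, hspec⟩ := exists_ae_eq_forall
    (exists_isConvexCombOfTori_or_eq_zero he hV) (htori.mono fun h hh => .inl hh)
  refine ⟨⟨lam, ⟨_, Kernel.measurable _, hlam⟩,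
    fun h hh => (hspec h).resolve_right fun hzero => hzero.1 hh,
    fun h hh => ((hspec h).resolve_left fun hcomb =>
      hh.2 (mem_image_compactPart_of_isConvexCombOfTori hcomb)).2,
    htori.mono fun h => mem_image_compactPart_of_isConvexCombOfTori,
    fun a ha => integral_regular_eq_integral_levelSet he hV hμR hlam ha⟩, fun z hz => ?_⟩
  refine measure_mono_null ?_ (measure_image_hamiltonianFlow_hamPerp_eq_zero he hV hinvPerp hinvP
    hz (isCompact_Icc (a := 0) (b := len e)))
  rintro _ ⟨s, h₀, h₁, rfl⟩
  exact ⟨s, ⟨h₀, h₁⟩, rfl⟩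

theorem propositionA1
    (Λ : AddSubgroup (Fin 2 → ℤ)) (hΛ : IsPrimitiveRankOne Λ)
    (e : Fin 2 → ℤ) (he : AddSubgroup.zmultiples e = Λ)
    (V : Torus → ℝ) (hV : SmoothOnTorus V)
    (μ : Measure Phase) (hμ : IsProbabilityMeasure μ) (hμR : μ (regular e V)ᶜ = 0)
    (hinvPerp : ∀ s : ℝ, MeasurePreserving (hamiltonianFlow (hamPerp e) s) μ μ)
    (hinvP : ∀ t : ℝ, MeasurePreserving (hamiltonianFlow (hamP e V) t) μ μ) :
    (∃ lam : ℝ × ℝ → Measure Phase,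
      AEMeasurable lam (μ.map (moment e V)) ∧
      (∀ h ∈ moment e V '' compactPart e V, IsConvexCombOfTori e V h (lam h)) ∧
      (∀ h ∈ moment e V '' regular e V \ moment e V '' compactPart e V, lam h = 0) ∧
      (∀ᵐ h ∂(μ.map (moment e V)), h ∈ moment e V '' compactPart e V) ∧
      ∀ a : Phase → ℝ, Continuous a → HasCompactSupport a → tsupport a ⊆ regular e V →
        IntegrableOn (fun h => ∫ z in levelSet e V h, a z ∂(lam h))
          (moment e V '' regular e V) (μ.map (moment e V)) ∧
        ∫ z in regular e V, a z ∂μ =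
          ∫ h in moment e V '' regular e V,
            (∫ z in levelSet e V h, a z ∂(lam h)) ∂(μ.map (moment e V))) ∧
    ∀ z ∈ regular e V,
      μ {w | ∃ s : ℝ, 0 ≤ s ∧ s ≤ len e ∧ w = hamiltonianFlow (hamPerp e) s z} = 0 := by
  obtain ⟨⟨lam, hmeas, hcomb, hzero, hmem, hint⟩, harc⟩ := propositionA1_general
    (ne_zero_of_isPrimitiveRankOne hΛ he) (hV.of_le (by norm_cast)) hμR hinvPerp hinvP
  exact ⟨⟨lam, hmeas, hcomb, hzero, hmem,
    fun a ha hac _ => hint a (ha.integrable_of_hasCompactSupport hac)⟩, harc⟩
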